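/- \textbf{Setting.} Let $A\neq 0$ be a unital $C^*$-algebra and $L$ an $A$-bimodule (over $\mathbb{C}$) that is finitely generated projective as a left module, with dual basis $e^i\in L$, $e_i\in L^\circ={}_A\mathrm{Hom}(L,A)$ ($1\le i\le n$), i.e. $f=\sum_i e_i(f)\,e^i$ for all $f\in L$. Assume: (1) $L$ is a left line module: $\mathrm{coev}:A\to L^\circ\otimes_A L$, $a\mapsto\sum_i e_i\otimes e^i a$, and $\mathrm{ev}:L\otimes_A L^\circ\to A$, $e\otimes\alpha\mapsto\alpha(e)$, are bijective, where $(\alpha a)(e)=\alpha(e)a$ and $(a\alpha)(e)=\alpha(ea)$. (2) There is a star operation on $L$: an additive map $e\mapsto e^*$ with $(a e)^*=e^*a^*$, $(ea)^*=a^*e^*$, $e^{**}=e$. (3) $\langle e,\overline f\rangle\in A$ is a positive inner product making $L$ a (complete) left Hilbert $C^*$-module ($A$-linear in $e$, $\langle e,\overline f\rangle^*=\langle f,\overline e\rangle$), with $\langle ea,\overline f\rangle=\langle e,\overline{f a^*}\rangle$, and it is nondegenerate: $G:\overline L\to L^\circ$, $G(\overline f)=\langle\,\cdot\,,\overline f\rangle$,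 is bijective. Here $\overline L$ is the conjugate bimodule, $a\overline e=\overline{ea^*}$, $\overline e a=\overline{a^*e}$. (4) The metric is star compatible: with $\tau(e)=G(\overline{e^*})$, one has $\sum_i\mathrm{ev}(\tau^{-1}(e_i)\otimes \tau(e^i))=1$. (5) The matrix $g^{ij}=\langle e^i,\overline{e^j}\rangle$ has a Hermitian square root in $M_n(A)$, and there is $M\ge0$ with $|e_i(e^j a)|_A\le M|a|_A$ for all $i,j$ and $a\in A$. Let $B_L$ be the unital $*$-algebra of pairs $f=(f_0,f_1)$ of functions $f_0:\mathbb{R}\to A$, $f_1:\mathbb{R}\to L$, with pointwise linear structure, $f^*=(f_0^*,f_1^*)$ (pointwise) and product $fg=h$, \[h_0(x)=f_0(x)g_0(x)+x^2\langle f_1(x),\overline{g_1(x)^*}\rangle,\qquad h_1(x)=f_0(x)g_1(x)+f_1(x)g_0(x).\] Let $\mathcal B_a,\mathcal B_b,\mathcal B_c\subset B_L$ be the sets of those $(f_0,f_1)$ such that $f_1=\sum_i f_{1,i}\,e^i$ with $f_{1,i}:\mathbb{R}\to A$ continuous of compact support, and, respectively, (a) $f_0\in C_0(\mathbb{R},A)$;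 (b) $f_0\in C_0(\mathbb{R},A)+\mathbb{C}1$; (c) $f_0\in C(\mathbb{R}_\infty,A)$, with $\mathbb{R}_\infty$ the one-point compactification of $\mathbb{R}$. Suppose $A\subset\mathcal B(\mathcal H)$ is faithfully and unitally $*$-represented on a Hilbert space $\mathcal H$. Put $\mathcal H_0=C(\mathbb{R}_\infty,\mathcal H)$, and let $\mathcal H_1$ be the space of functions $x\mapsto\sum_i\overline{e^i}\otimes k_i(x)\in\overline L\otimes_A\mathcal H$ with $k_i:\mathbb{R}\to\mathcal H$ continuous of compact support. On $\overline L\otimes_A\mathcal H$ let $\langle\overline e\otimes u,\overline{e'}\otimes u'\rangle_1=\langle u,\langle e,\overline{e'}\rangle u'\rangle_{\mathcal H}$ (conjugate-linear in the first variable). Let $\mathcal H_{0,1}$ be the completion of $\mathcal H_0\oplus\mathcal H_1$ for \[\langle v,w\rangle_{0,1}=\int_{\mathbb{R}}\frac{\langle v_0(x),w_0(x)\rangle_{\mathcal H}+x^2\langle v_1(x),w_1(x)\rangle_1}{1+x^2}\,dx .\] \textbf{Theorem.} $\mathcal B_a$ is a $*$-subalgebra of $B_L$, and $\mathcal B_b$,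 $\mathcal B_c$ are unital $*$-subalgebras. For $f\in\mathcal B_c$ and $v\in\mathcal H_0\oplus\mathcal H_1$ the formulas \[w_0(x)=f_0(x)v_0(x)+x^2\langle f_1(x),v_1(x)\rangle,\qquad w_1(x)=\overline{f_1(x)^*}\otimes v_0(x)+f_0(x)v_1(x),\] where $\langle f,\overline e\otimes u\rangle=\langle f,\overline e\rangle u$ and $a(\overline e\otimes u)=\overline{ea^*}\otimes u$, define an element $w\in\mathcal H_0\oplus\mathcal H_1$, and $v\mapsto w$ extends to a bounded operator $\rho(f)$ on $\mathcal H_{0,1}$. The map $\rho:\mathcal B_c\to\mathcal B(\mathcal H_{0,1})$ is a unital $*$-homomorphism, and there is a constant $C\ge0$, depending only on $A$, $L$ and the given structure on $L$ (not on $f$ or $\mathcal H$), with \[\|\rho(f)\|\le C\Big(\sup_{x}|f_0(x)|_A^2+\sup_x x^2\big(|\langle f_1(x)^*,\overline{f_1(x)^*}\rangle|_A+|\langle f_1(x),\overline{f_1(x)}\rangle|_A\big)\Big)^{1/2}.\] The operator-norm closures of $\rho(\mathcal B_a)$, $\rho(\mathcal B_b)$, $\rho(\mathcal B_c)$ are three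 $C^*$-algebras $\mathfrak A_a,\mathfrak A_b,\mathfrak A_c$ of operators on $\mathcal H_{0,1}$: a) $\mathfrak A_a$ (functions vanishing at infinity on the fibres) is non-unital: it has no unit element; b) $\mathfrak A_b$ (the Thom algebra) is unital and arises from $\mathfrak A_a$ by adjoining $\mathbb{C}$: $z+T\mapsto z1+T$ is a $*$-isomorphism from the unitization $\mathbb{C}\oplus\mathfrak A_a$ onto $\mathfrak A_b$; c) $\mathfrak A_c$ (the associated circle bundle algebra) is unital. -/

import Mathlib

open scoped TensorProduct ComplexConjugate Matrix ZeroAtInfty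
open MulOpposite MeasureTheory

noncomputable section

set_option linter.unusedSectionVars false

/-! ### Balanced tensor products over a noncommutative algebra

For a right `A`-module `M` with right action `r a m = m.a` and a left `A`-module `N` with left
action `l a n = a.n`, the tensor product over `A` is the quotient of `M ⊗[ℂ] N` by the relations
`m.a ⊗ n = m ⊗ a.n`. -/

section Balanced

variable {A M N P : Type*} [AddCommGroup M] [Module ℂ M] [AddCommGroup N] [Module ℂ N]
  [AddCommGroup P] [Module ℂ P]

/-- The span of all `m.a ⊗ n - m ⊗ a.n`. -/
def balancedRel (r : A → M → M) (l : A → N → N) : Submodule ℂ (M ⊗[ℂ] N) :=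
  Submodule.span ℂ {t | ∃ m a n, t = r a m ⊗ₜ[ℂ] n - m ⊗ₜ[ℂ] l a n}

/-- The tensor product `M ⊗_A N`. -/
abbrev BalancedTensor (r : A → M → M) (l : A → N → N) : Type _ :=
  (M ⊗[ℂ] N) ⧸ balancedRel r l

/-- The elementary tensor `m ⊗_A n`. -/
def balancedTmul (r : A → M → M) (l : A → N → N) (m : M) (n : N) : BalancedTensor r l :=
  Submodule.Quotient.mk (m ⊗ₜ[ℂ] n)

/-- The linear map on `M ⊗_A N` induced by an `A`-balanced bilinear map. -/
def balancedLift (r : A → M → M) (l : A → N → N) (f : M →ₗ[ℂ] N →ₗ[ℂ] P)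
    (hf : ∀ a m n, f (r a m) n = f m (l a n)) : BalancedTensor r l →ₗ[ℂ] P :=
  (balancedRel r l).liftQ (TensorProduct.lift f) (by
    refine Submodule.span_le.2 ?_
    rintro _ ⟨m, a, n, rfl⟩
    simp [hf])

@[simp] theorem balancedLift_tmul (r : A → M → M) (l : A → N → N) (f : M →ₗ[ℂ] N →ₗ[ℂ] P)
    (hf : ∀ a m n, f (r a m) n = f m (l a n)) (m : M) (n : N) :
    balancedLift r l f hf (balancedTmul r l m n) = f m n := by
  rw [balancedLift, balancedTmul]
  exact (Submodule.liftQ_apply _ _ _).trans (TensorProduct.lift.tmul _ _)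

theorem balanced_induction {r : A → M → M} {l : A → N → N} {p : BalancedTensor r l → Prop}
    (t : BalancedTensor r l) (h0 : p 0) (ht : ∀ m n, p (balancedTmul r l m n))
    (ha : ∀ s t, p s → p t → p (s + t)) : p t := by
  obtain ⟨t, rfl⟩ := Submodule.Quotient.mk_surjective _ t
  induction t with
  | zero => exact h0
  | tmul m n => exact ht m n
  | add s t hs ht => exact ha _ _ hs ht

theorem balancedTmul_rel (r : A → M → M) (l : A → N → N) (a : A) (m : M) (n : N) :
    balancedTmul r l (r a m) n = balancedTmul r l m (l a n) :=
  (Submodule.Quotient.eq _).2 (Submodule.subset_span ⟨m, a, n, rfl⟩)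

theorem balancedTmul_add_left (r : A → M → M) (l : A → N → N) (m m' : M) (n : N) :
    balancedTmul r l (m + m') n = balancedTmul r l m n + balancedTmul r l m' n :=
  congrArg Submodule.Quotient.mk (TensorProduct.add_tmul m m' n)

theorem balancedTmul_smul_left (r : A → M → M) (l : A → N → N) (z : ℂ) (m : M) (n : N) :
    balancedTmul r l (z • m) n = z • balancedTmul r l m n :=
  congrArg Submodule.Quotient.mk (TensorProduct.smul_tmul' z m n).symm

theorem balancedTmul_add_right (r : A → M → M) (l : A → N → N) (m : M) (n n' : N) :
    balancedTmul r l m (n + n') = balancedTmul r l m n + balancedTmul r l m n' :=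
  congrArg Submodule.Quotient.mk (TensorProduct.tmul_add m n n')

theorem balancedTmul_smul_right (r : A → M → M) (l : A → N → N) (z : ℂ) (m : M) (n : N) :
    balancedTmul r l m (z • n) = z • balancedTmul r l m n :=
  congrArg Submodule.Quotient.mk (TensorProduct.tmul_smul z m n)

end Balanced

/-! ### The conjugate of a complex vector space -/

/-- The conjugate `L̄` of a complex vector space `L`. -/
def ConjModule (L : Type*) : Type _ := L

/-- The element `ē` of `L̄`. -/
def toConj {L : Type*} (e : L) : ConjModule L := e

/-- The element `e` of `L` with `ē` given. -/
def ofConj {L : Type*} (e : ConjModule L) : L := e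

instance {L : Type*} [AddCommGroup L] : AddCommGroup (ConjModule L) := inferInstanceAs (AddCommGroup L)

/-- The complex structure `z ē = \overline{z̄ e}`. -/
instance {L : Type*} [AddCommGroup L] [Module ℂ L] : Module ℂ (ConjModule L) :=
  Module.compHom L (starRingEnd ℂ)

theorem ofConj_smul {L : Type*} [AddCommGroup L] [Module ℂ L] (z : ℂ) (e : ConjModule L) :
    ofConj (z • e) = conj z • ofConj e := rfl

theorem ofConj_add {L : Type*} [AddCommGroup L] (e f : ConjModule L) :
    ofConj (e + f) = ofConj e + ofConj f := rfl

/-! ### Bimodules, duals, line modules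

`L` is an `A`-bimodule: the right action of `a` on `e` is `op a • e`.  The left dual `L°` is
`L →ₗ[A] A`, with `(α.a)(e) = α(e) a` and `(a.α)(e) = α(e.a)`. -/

section Line

variable {A : Type*} [CStarAlgebra A] [PartialOrder A] [StarOrderedRing A]
  {L : Type*} [NormedAddCommGroup L] [Module ℂ L] [Module A L] [Module Aᵐᵒᵖ L]
  [SMulCommClass A Aᵐᵒᵖ L] [IsScalarTower ℂ A L] [IsScalarTower ℂ Aᵐᵒᵖ L]

variable (L) in
/-- Right multiplication `e ↦ e.a`, a left module map. -/
def rightMul (a : A) : L →ₗ[A] L where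
  toFun e := op a • e
  map_add' := smul_add _
  map_smul' b e := (smul_comm b (op a) e).symm

variable (A L) in
/-- `L ⊗_A L°`. -/
abbrev TensorDual : Type _ :=
  BalancedTensor (M := L) (N := L →ₗ[A] A) (fun (a : A) e => op a • e)
    (fun a α => α ∘ₗ rightMul L a)

variable (A L) in
/-- `L° ⊗_A L`. -/
abbrev DualTensor : Type _ :=
  BalancedTensor (M := L →ₗ[A] A) (N := L) (fun (a : A) α => op a • α) (fun a e => a • e)

variable (A L) in
/-- The evaluation map `ev : L ⊗_A L° → A`, `e ⊗ α ↦ α(e)`. -/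
def evMap : TensorDual A L →ₗ[ℂ] A :=
  balancedLift _ _
    (LinearMap.mk₂ ℂ (fun (e : L) (α : L →ₗ[A] A) => α e)
      (fun _ _ _ => map_add _ _ _)
      (fun z e α => by
        rw [← algebraMap_smul A z e, map_smul, algebraMap_smul])
      (fun _ _ _ => rfl) (fun _ _ _ => rfl))
    (fun _ _ _ => rfl)

variable (A L) in
/-- A dual basis `e^i ∈ L`, `e_i ∈ L°` with `f = ∑ e_i(f).e^i`, exhibiting `L` as a finitely
generated projective left `A`-module. -/
structure DualBasis (n : ℕ) where
  /-- The elements `e^i` of `L`. -/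
  vec : Fin n → L
  /-- The elements `e_i` of `L°`. -/
  covec : Fin n → (L →ₗ[A] A)
  expand : ∀ f, ∑ i, covec i f • vec i = f

/-- The coevaluation map `coev : A → L° ⊗_A L`, `a ↦ ∑ e_i ⊗ e^i.a`. -/
def coevMap {n : ℕ} (b : DualBasis A L n) (a : A) : DualTensor A L :=
  ∑ i, balancedTmul _ _ (b.covec i) (op a • b.vec i)

/-- `L` is a left line module: coevaluation and evaluation are isomorphisms. -/
structure DualBasis.IsLeftLine {n : ℕ} (b : DualBasis A L n) : Prop where
  coev_bijective : Function.Bijective (coevMap b)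
  ev_bijective : Function.Bijective (evMap A L)

variable (A L) in
/-- A star operation on the bimodule `L`: an involutive bimodule map `L → L̄`, `e ↦ \overline{e*}`. -/
structure BimoduleStar where
  /-- `e ↦ e*` -/
  st : L → L
  st_add : ∀ e f, st (e + f) = st e + st f
  st_smul : ∀ (a : A) (e : L), st (a • e) = op (star a) • st e
  st_op_smul : ∀ (a : A) (e : L), st (op a • e) = star a • st e
  st_st : ∀ e, st (st e) = e

variable [CStarModule A L]

/-- The inner product `⟨e, f̄⟩`, `A`-linear in `e`.  (Mathlib's inner product on a Hilbert
C⋆-module is linear in its second argument.) -/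
def pair (A : Type*) {L : Type*} [Inner A L] (e f : L) : A := inner A f e

variable (A) in
/-- `G(f̄) = ⟨·, f̄⟩ ∈ L°`. -/
def metricMap (f : L) : L →ₗ[A] A where
  toFun e := pair A e f
  map_add' _ _ := CStarModule.inner_add_right
  map_smul' _ _ := CStarModule.inner_op_smul_right

variable (A L) in
/-- The Hilbert C⋆-module inner product is a nondegenerate Hermitian metric on the bimodule: `G` is
an invertible bimodule map `L̄ → L°`.  (Right linearity and the Hermitian symmetry hold in every
Hilbert C⋆-module; left linearity `G(a.f̄) = a.G(f̄)` reads `⟨e, \overline{f.a*}⟩ = ⟨e.a, f̄⟩`.) -/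
structure IsNondegenerateMetric : Prop where
  left_linear : ∀ (a : A) (f : L), metricMap A (op (star a) • f) = metricMap A f ∘ₗ rightMul L a
  bijective : Function.Bijective (metricMap A : L → (L →ₗ[A] A))

/-- The element `α ∈ A`, the image of `1` under
`A → L° ⊗_A L → L ⊗_A L° → A`, the maps being `coev`, `(G⋆)⁻¹ ⊗ G⋆` and `ev`. -/
def metricAlpha {n : ℕ} (b : DualBasis A L n) (s : BimoduleStar A L)
    (h : IsNondegenerateMetric A L) : A :=
  ∑ i, metricMap A (s.st (b.vec i)) (s.st ((Equiv.ofBijective _ h.bijective).symm (b.covec i)))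

/-- The matrix `g^{ij} = ⟨e^i, \overline{e^j}⟩`. -/
def metricMatrix {n : ℕ} (b : DualBasis A L n) : Matrix (Fin n) (Fin n) A :=
  Matrix.of fun i j => pair A (b.vec i) (b.vec j)

variable (A L) in
/-- A left line module over the C⋆-algebra `A` with a star operation and a star compatible
nondegenerate Hermitian metric which is a Hilbert C⋆-module inner product, such that the matrix
`g^{ij}` has a Hermitian square root and the right action is bounded in terms of the dual basis. -/
structure HermitianLine (n : ℕ) where
  /-- the dual basis -/
  basis : DualBasis A L n
  isLine : basis.IsLeftLine
  /-- the star operation of `L` -/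
  invol : BimoduleStar A L
  metric : IsNondegenerateMetric A L
  star_compatible : metricAlpha basis invol metric = 1
  root : ∃ r : Matrix (Fin n) (Fin n) A, rᴴ = r ∧ r * r = metricMatrix basis
  bounded : ∃ M : ℝ, 0 ≤ M ∧ ∀ i j (a : A), ‖basis.covec i (op a • basis.vec j)‖ ≤ M * ‖a‖

/-! ### Basic facts on the pairing -/

theorem pair_add_left (e e' f : L) : pair A (e + e') f = pair A e f + pair A e' f :=
  CStarModule.inner_add_right

theorem pair_add_right (e f f' : L) : pair A e (f + f') = pair A e f + pair A e f' :=
  CStarModule.inner_add_left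

theorem pair_smul_left (a : A) (e f : L) : pair A (a • e) f = a * pair A e f :=
  CStarModule.inner_op_smul_right

theorem pair_smul_right (a : A) (e f : L) : pair A e (a • f) = pair A e f * star a :=
  CStarModule.inner_op_smul_left

theorem pair_csmul_left (z : ℂ) (e f : L) : pair A (z • e) f = z • pair A e f :=
  CStarModule.inner_smul_right_complex

theorem pair_csmul_right (z : ℂ) (e f : L) : pair A e (z • f) = conj z • pair A e f :=
  CStarModule.inner_smul_left_complex

theorem star_pair (e f : L) : star (pair A e f) = pair A f e :=
  CStarModule.star_inner _ _

theorem pair_op_smul_left (h : IsNondegenerateMetric A L) (a : A) (e f : L) :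
    pair A (op a • e) f = pair A e (op (star a) • f) :=
  (LinearMap.congr_fun (h.left_linear a f) e).symm

theorem BimoduleStar.st_csmul (s : BimoduleStar A L) (z : ℂ) (e : L) :
    s.st (z • e) = conj z • s.st e := by
  rw [← algebraMap_smul A z e, s.st_smul, ← algebraMap_smul Aᵐᵒᵖ (conj z) (s.st e)]
  congr 1
  rw [← algebraMap_star_comm]
  rfl

/-- `e.⟨f, \overline{h*}⟩ = ⟨e, \overline{f*}⟩.h` -/
theorem HermitianLine.triple {n : ℕ} (D : HermitianLine A L n) (e f h : L) :
    op (pair A f (D.invol.st h)) • e = pair A e (D.invol.st f) • h := by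
  set s := D.invol
  set E := Equiv.ofBijective _ D.metric.bijective with hE
  have E_apply : ∀ x, E x = metricMap A x := fun x => rfl
  have E_add : ∀ x y, E (x + y) = E x + E y := by
    intro x y; ext e; exact pair_add_right _ _ _
  have Es_add : ∀ α β, E.symm (α + β) = E.symm α + E.symm β := by
    intro α β; apply E.injective; simp [E_add]
  have Es_op : ∀ (a : A) α, E.symm (op a • α) = star a • E.symm α := by
    intro a α; apply E.injective
    ext e
    have h1 : (E (star a • E.symm α)) e = (E (E.symm α)) e * star (star a) :=
      pair_smul_right _ _ _
    rw [h1, star_star, Equiv.apply_symm_apply, Equiv.apply_symm_apply]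
    rfl
  have Es_smul : ∀ (z : ℂ) α, E.symm (z • α) = conj z • E.symm α := by
    intro z α; apply E.injective
    ext e
    have h1 : (E (conj z • E.symm α)) e = conj (conj z) • (E (E.symm α)) e :=
      pair_csmul_right _ _ _
    rw [h1, Complex.conj_conj, Equiv.apply_symm_apply, Equiv.apply_symm_apply]
    rfl
  have op_c : ∀ (z : ℂ) (e : L), op (algebraMap ℂ A z) • e = z • e := fun z e =>
    algebraMap_smul Aᵐᵒᵖ z e
  let Ψ : DualTensor A L →ₗ[ℂ] A := balancedLift _ _
    (LinearMap.mk₂ ℂ (fun (α : L →ₗ[A] A) (x : L) => pair A (s.st (E.symm α)) (s.st x))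
      (fun α β x => by rw [Es_add, s.st_add, pair_add_left])
      (fun z α x => by rw [Es_smul, s.st_csmul, Complex.conj_conj, pair_csmul_left])
      (fun α x y => by rw [s.st_add, pair_add_right])
      (fun z α x => by rw [s.st_csmul, pair_csmul_right, Complex.conj_conj]))
    (fun a α x => by
      simp only [LinearMap.mk₂_apply]
      rw [Es_op, s.st_smul, star_star, pair_op_smul_left D.metric, s.st_smul])
  let Θ : DualTensor A L →ₗ[ℂ] L := balancedLift _ _
    (LinearMap.mk₂ ℂ (fun (α : L →ₗ[A] A) (x : L) => α e • x)
      (fun α β x => add_smul _ _ _)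
      (fun z α x => smul_assoc _ _ _)
      (fun α x y => smul_add _ _ _)
      (fun z α x => (smul_comm _ _ _)))
    (fun a α x => by
      simp only [LinearMap.mk₂_apply]
      exact mul_smul (α e) a x)
  obtain ⟨a, ha⟩ := D.isLine.coev_bijective.2 (balancedTmul _ _ (metricMap A (s.st f)) h)
  have h1 : a = pair A f (s.st h) := by
    have h2 : Ψ (coevMap D.basis a) = a := by
      rw [coevMap, map_sum]
      have h3 : ∀ i, Ψ (balancedTmul _ _ (D.basis.covec i) (op a • D.basis.vec i)) =
          metricMap A (s.st (D.basis.vec i)) (s.st (E.symm (D.basis.covec i))) * a := by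
        intro i
        simp only [Ψ, balancedLift_tmul, LinearMap.mk₂_apply]
        rw [s.st_op_smul, pair_smul_right, star_star]
        rfl
      rw [Finset.sum_congr rfl fun i _ => h3 i, ← Finset.sum_mul]
      have h4 := D.star_compatible
      rw [metricAlpha] at h4
      rw [h4, one_mul]
    rw [← h2, ha]
    simp only [Ψ, balancedLift_tmul, LinearMap.mk₂_apply]
    rw [← E_apply, Equiv.symm_apply_apply, s.st_st]
  have h5 : Θ (coevMap D.basis a) = op a • e := by
    rw [coevMap, map_sum]
    have h3 : ∀ i, Θ (balancedTmul _ _ (D.basis.covec i) (op a • D.basis.vec i)) =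
        op a • (D.basis.covec i e • D.basis.vec i) := by
      intro i
      simp only [Θ, balancedLift_tmul, LinearMap.mk₂_apply]
      exact smul_comm _ _ _
    rw [Finset.sum_congr rfl fun i _ => h3 i, ← Finset.smul_sum, D.basis.expand]
  rw [← h1, ← h5, ha]
  simp only [Θ, balancedLift_tmul, LinearMap.mk₂_apply]
  rfl

/-! ### The algebra `B_L` -/

/-- The pairs `(f₀, f₁)` of functions `f₀ : ℝ → A`, `f₁ : ℝ → L`. -/
@[ext] structure HermitianLine.BL {n : ℕ} (D : HermitianLine A L n) where
  /-- `f₀` -/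
  f0 : ℝ → A
  /-- `f₁` -/
  f1 : ℝ → L

namespace HermitianLine

variable {n : ℕ} (D : HermitianLine A L n)

instance : Zero D.BL := ⟨⟨0, 0⟩⟩
instance : Add D.BL := ⟨fun f g => ⟨f.f0 + g.f0, f.f1 + g.f1⟩⟩
instance : Neg D.BL := ⟨fun f => ⟨-f.f0, -f.f1⟩⟩
instance : SMul ℂ D.BL := ⟨fun z f => ⟨z • f.f0, z • f.f1⟩⟩
instance : One D.BL := ⟨⟨1, 0⟩⟩

/-- The product `h₀ = f₀ g₀ + x² ⟨f₁, \overline{g₁*}⟩`, `h₁ = f₀.g₁ + f₁.g₀`. -/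
instance : Mul D.BL where
  mul f g :=
    ⟨fun x => f.f0 x * g.f0 x + (x : ℂ) ^ 2 • pair A (f.f1 x) (D.invol.st (g.f1 x)),
     fun x => f.f0 x • g.f1 x + op (g.f0 x) • f.f1 x⟩

/-- The star operation `(f₀, f₁)* = (f₀*, f₁*)`. -/
instance : Star D.BL where
  star f := ⟨fun x => star (f.f0 x), fun x => D.invol.st (f.f1 x)⟩

theorem BL_ext {f g : D.BL} (h0 : ∀ x, f.f0 x = g.f0 x) (h1 : ∀ x, f.f1 x = g.f1 x) : f = g :=
  BL.ext (funext h0) (funext h1)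

theorem add_fst (f g : D.BL) (x : ℝ) : (f + g).f0 x = f.f0 x + g.f0 x := rfl
theorem add_snd (f g : D.BL) (x : ℝ) : (f + g).f1 x = f.f1 x + g.f1 x := rfl
theorem neg_fst (f : D.BL) (x : ℝ) : (-f).f0 x = -f.f0 x := rfl
theorem neg_snd (f : D.BL) (x : ℝ) : (-f).f1 x = -f.f1 x := rfl
theorem smul_fst (z : ℂ) (f : D.BL) (x : ℝ) : (z • f).f0 x = z • f.f0 x := rfl
theorem smul_snd (z : ℂ) (f : D.BL) (x : ℝ) : (z • f).f1 x = z • f.f1 x := rfl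
theorem zero_fst (x : ℝ) : (0 : D.BL).f0 x = 0 := rfl
theorem zero_snd (x : ℝ) : (0 : D.BL).f1 x = 0 := rfl
theorem one_fst (x : ℝ) : (1 : D.BL).f0 x = 1 := rfl
theorem one_snd (x : ℝ) : (1 : D.BL).f1 x = 0 := rfl
theorem mul_fst (f g : D.BL) (x : ℝ) : (f * g).f0 x =
    f.f0 x * g.f0 x + (x : ℂ) ^ 2 • pair A (f.f1 x) (D.invol.st (g.f1 x)) := rfl
theorem mul_snd (f g : D.BL) (x : ℝ) :
    (f * g).f1 x = f.f0 x • g.f1 x + op (g.f0 x) • f.f1 x := rfl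
theorem star_fst (f : D.BL) (x : ℝ) : (star f).f0 x = star (f.f0 x) := rfl
theorem star_snd (f : D.BL) (x : ℝ) : (star f).f1 x = D.invol.st (f.f1 x) := rfl

theorem st_zero : D.invol.st 0 = 0 := by
  have := D.invol.st_add 0 0
  simpa using this

theorem pair_zero_left (f : L) : pair A 0 f = 0 := by
  have := pair_add_left (A := A) 0 0 f
  simpa using this

theorem pair_zero_right (f : L) : pair A f 0 = 0 := by
  have := pair_add_right (A := A) f 0 0
  simpa using this

theorem op_csmul (z : ℂ) (a : A) (e : L) : op (z • a) • e = z • op a • e := by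
  rw [op_smul, smul_assoc]

instance : Ring D.BL where
  add_assoc _ _ _ := BL.ext (add_assoc _ _ _) (add_assoc _ _ _)
  zero_add _ := BL.ext (zero_add _) (zero_add _)
  add_zero _ := BL.ext (add_zero _) (add_zero _)
  add_comm _ _ := BL.ext (add_comm _ _) (add_comm _ _)
  neg_add_cancel _ := BL.ext (neg_add_cancel _) (neg_add_cancel _)
  nsmul := nsmulRec
  zsmul := zsmulRec
  left_distrib f g h := by
    refine D.BL_ext (fun x => ?_) fun x => ?_
    · simp only [mul_fst, add_fst, add_snd, D.invol.st_add, pair_add_right, smul_add, mul_add]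
      abel
    · simp only [mul_snd, add_fst, add_snd, smul_add, op_add, add_smul]
      abel
  right_distrib f g h := by
    refine D.BL_ext (fun x => ?_) fun x => ?_
    · simp only [mul_fst, add_fst, add_snd, pair_add_left, smul_add, add_mul]
      abel
    · simp only [mul_snd, add_fst, add_snd, smul_add, add_smul]
      abel
  zero_mul f := by
    refine D.BL_ext (fun x => ?_) fun x => ?_
    · simp [mul_fst, zero_fst, zero_snd, pair_zero_left]
    · simp [mul_snd, zero_fst, zero_snd]
  mul_zero f := by
    refine D.BL_ext (fun x => ?_) fun x => ?_
    · simp [mul_fst, zero_fst, zero_snd, pair_zero_right, D.st_zero]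
    · simp [mul_snd, zero_fst, zero_snd]
  one_mul f := by
    refine D.BL_ext (fun x => ?_) fun x => ?_
    · simp [mul_fst, one_fst, one_snd, pair_zero_left]
    · simp [mul_snd, one_fst, one_snd]
  mul_one f := by
    refine D.BL_ext (fun x => ?_) fun x => ?_
    · simp [mul_fst, one_fst, one_snd, pair_zero_right, D.st_zero]
    · simp [mul_snd, one_fst, one_snd]
  mul_assoc f g h := by
    refine D.BL_ext (fun x => ?_) fun x => ?_
    · simp only [mul_fst, mul_snd, D.invol.st_add, D.invol.st_smul, D.invol.st_op_smul,
        pair_add_left, pair_add_right, pair_smul_left, pair_smul_right,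
        pair_op_smul_left D.metric, star_star, smul_add, mul_add, add_mul, mul_assoc,
        smul_mul_assoc, mul_smul_comm]
      abel
    · simp only [mul_fst, mul_snd, smul_add, add_smul, op_add, mul_smul, op_mul, op_csmul,
        D.triple, smul_assoc, smul_comm (f.f0 x) (op (h.f0 x)) (g.f1 x)]
      abel

instance : Module ℂ D.BL where
  one_smul _ := BL.ext (one_smul _ _) (one_smul _ _)
  mul_smul _ _ _ := BL.ext (mul_smul _ _ _) (mul_smul _ _ _)
  smul_zero _ := BL.ext (smul_zero _) (smul_zero _)
  smul_add _ _ _ := BL.ext (smul_add _ _ _) (smul_add _ _ _)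
  add_smul _ _ _ := BL.ext (add_smul _ _ _) (add_smul _ _ _)
  zero_smul _ := BL.ext (zero_smul _ _) (zero_smul _ _)

instance : Algebra ℂ D.BL :=
  Algebra.ofModule
    (fun z f g => by
      refine D.BL_ext (fun x => ?_) fun x => ?_
      · simp only [mul_fst, smul_fst, smul_snd, pair_csmul_left, smul_add, smul_mul_assoc]
        rw [smul_comm]
      · simp only [mul_snd, smul_fst, smul_snd, smul_add, smul_assoc]
        rw [smul_comm (op (g.f0 x)) z])
    (fun z f g => by
      refine D.BL_ext (fun x => ?_) fun x => ?_
      · simp only [mul_fst, smul_fst, smul_snd, D.invol.st_csmul, pair_csmul_right,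
          Complex.conj_conj, smul_add, mul_smul_comm]
        rw [smul_comm]
      · simp only [mul_snd, smul_fst, smul_snd, smul_add, op_csmul]
        rw [smul_comm (f.f0 x) z])

instance : StarRing D.BL where
  star_involutive f := D.BL_ext (fun x => star_star _) fun x => D.invol.st_st _
  star_mul f g := by
    refine D.BL_ext (fun x => ?_) fun x => ?_
    · simp only [star_fst, mul_fst, star_snd, star_add, star_mul, star_smul, star_pair,
        D.invol.st_st]
      simp
    · simp only [star_snd, mul_snd, star_fst, D.invol.st_add, D.invol.st_smul,
        D.invol.st_op_smul]
      rw [add_comm]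
  star_add f g := D.BL_ext (fun x => star_add _ _) fun x => D.invol.st_add _ _

instance : StarModule ℂ D.BL where
  star_smul _ _ := D.BL_ext (fun _ => star_smul _ _) fun _ => D.invol.st_csmul _ _

/-! ### The Hilbert space `H_{0,1}` -/

variable {H : Type*} [NormedAddCommGroup H] [InnerProductSpace ℂ H] [CompleteSpace H]
  (π : A →⋆ₐ[ℂ] (H →L[ℂ] H))

variable (L) in
/-- `L̄ ⊗_A H`, where `ē.a = \overline{a*.e}` and `A` acts on `H` through `π`. -/
abbrev ConjTensor : Type _ :=
  BalancedTensor (M := ConjModule L) (N := H)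
    (fun (a : A) e => toConj (star a • ofConj e)) (fun a u => π a u)

/-- The elementary tensor `ē ⊗ u`. -/
def conjTmul (e : L) (u : H) : ConjTensor L π := balancedTmul _ _ (toConj e) u

/-- The pairing `f ⊗ (ē ⊗ u) ↦ ⟨f, ē⟩ ▷ u`. -/
def pairAct : ConjTensor L π →ₗ[ℂ] (L → H) :=
  balancedLift _ _
    (LinearMap.mk₂ ℂ (fun (e : ConjModule L) (u : H) => fun f : L => π (pair A f (ofConj e)) u)
      (fun e e' u => by
        funext f
        simp only [ofConj_add, pair_add_right, map_add, Pi.add_apply]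
        rfl)
      (fun z e u => by
        funext f
        simp only [ofConj_smul, pair_csmul_right, Complex.conj_conj, map_smul, Pi.smul_apply]
        rfl)
      (fun e u v => by
        funext f
        simp only [map_add, Pi.add_apply])
      (fun z e u => by
        funext f
        simp only [map_smul, Pi.smul_apply]))
    (fun a e u => by
      funext f
      simp only [LinearMap.mk₂_apply]
      change π (pair A f (star a • ofConj e)) u = _
      rw [pair_smul_right, star_star, map_mul]
      rfl)

theorem pairAct_tmul (e : L) (u : H) (f : L) :
    pairAct π (conjTmul π e u) f = π (pair A f e) u := by
  rw [pairAct, conjTmul, balancedLift_tmul]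
  rfl

/-- The left action `a ▷ (ē ⊗ u) = \overline{e.a*} ⊗ u` on `L̄ ⊗_A H`. -/
def leftAct (a : A) : ConjTensor L π →ₗ[ℂ] ConjTensor L π :=
  balancedLift _ _
    (LinearMap.mk₂ ℂ (fun (e : ConjModule L) (u : H) => conjTmul π (op (star a) • ofConj e) u)
      (fun e e' u => by
        rw [ofConj_add, smul_add]
        exact balancedTmul_add_left _ _ (toConj (op (star a) • ofConj e))
          (toConj (op (star a) • ofConj e')) u)
      (fun z e u => by
        rw [ofConj_smul, smul_comm]
        exact balancedTmul_smul_left _ _ z (toConj (op (star a) • ofConj e)) u)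
      (fun _ _ _ => balancedTmul_add_right _ _ _ _ _)
      (fun _ _ _ => balancedTmul_smul_right _ _ _ _ _))
    (fun b e u => by
      change conjTmul π (op (star a) • star b • ofConj e) u =
        conjTmul π (op (star a) • ofConj e) (π b u)
      rw [← smul_comm (star b) (op (star a)) (ofConj e)]
      exact balancedTmul_rel _ _ b (toConj (op (star a) • ofConj e)) u)

theorem leftAct_tmul (a : A) (e : L) (u : H) :
    leftAct π a (conjTmul π e u) = conjTmul π (op (star a) • e) u := by
  rw [leftAct, conjTmul, balancedLift_tmul]
  rfl

theorem pairAct_add (w : ConjTensor L π) (f g : L) :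
    pairAct π w (f + g) = pairAct π w f + pairAct π w g := by
  induction w using balanced_induction with
  | h0 => simp
  | ht e u =>
    have := pairAct_tmul π (ofConj e)  u
    simp only [conjTmul] at this
    change pairAct π (balancedTmul _ _ (toConj (ofConj e)) u) _ =
      pairAct π (balancedTmul _ _ (toConj (ofConj e)) u) _ +
      pairAct π (balancedTmul _ _ (toConj (ofConj e)) u) _
    rw [this, this, this, pair_add_left, map_add]
    rfl
  | ha s t hs ht =>
    simp only [map_add, Pi.add_apply, hs, ht]
    abel

theorem pairAct_smul (w : ConjTensor L π) (a : A) (f : L) :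
    pairAct π w (a • f) = π a (pairAct π w f) := by
  induction w using balanced_induction with
  | h0 => simp
  | ht e u =>
    have := pairAct_tmul π (ofConj e)  u
    simp only [conjTmul] at this
    change pairAct π (balancedTmul _ _ (toConj (ofConj e)) u) _ =
      π a (pairAct π (balancedTmul _ _ (toConj (ofConj e)) u) _)
    rw [this, this, pair_smul_left, map_mul]
    rfl
  | ha s t hs ht =>
    simp only [map_add, Pi.add_apply, hs, ht]

theorem pairAct_csmul (w : ConjTensor L π) (z : ℂ) (f : L) :
    pairAct π w (z • f) = z • pairAct π w f := by
  rw [← algebraMap_smul A z f, pairAct_smul, AlgHomClass.commutes]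
  rfl

/-- The inner product with a fixed `w` in its second variable, conjugated. -/
def innerAux (w : ConjTensor L π) : ConjTensor L π →ₗ[ℂ] ℂ :=
  balancedLift _ _
    (LinearMap.mk₂ ℂ (fun (e : ConjModule L) (u : H) => inner ℂ (pairAct π w (ofConj e)) u)
      (fun e e' u => by rw [ofConj_add, pairAct_add, inner_add_left])
      (fun z e u => by
        rw [ofConj_smul, pairAct_csmul, inner_smul_left, Complex.conj_conj]
        rfl)
      (fun e u v => inner_add_right _ _ _)
      (fun z e u => inner_smul_right _ _ _))
    (fun a e u => by
      simp only [LinearMap.mk₂_apply]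
      change inner ℂ (pairAct π w (star a • ofConj e)) u = _
      rw [pairAct_smul, map_star, ContinuousLinearMap.star_eq_adjoint,
        ContinuousLinearMap.adjoint_inner_left])

/-- The sesquilinear form on `L̄ ⊗_A H` determined by
`(ē ⊗ u, ē' ⊗ u') ↦ ⟨u, ⟨e, ē'⟩ ▷ u'⟩_H`, conjugate linear in the first variable. -/
def tensorInner (t w : ConjTensor L π) : ℂ := conj (innerAux π w t)

theorem tensorInner_tmul_left (e : L) (u : H) (w : ConjTensor L π) :
    tensorInner π (conjTmul π e u) w = inner ℂ u (pairAct π w e) := by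
  rw [tensorInner, innerAux, conjTmul, balancedLift_tmul, LinearMap.mk₂_apply, inner_conj_symm]
  rfl

theorem tensorInner_tmul (e e' : L) (u u' : H) :
    tensorInner π (conjTmul π e u) (conjTmul π e' u') = inner ℂ u (π (pair A e e') u') := by
  rw [tensorInner_tmul_left, pairAct_tmul]

theorem tensorInner_add_left (s t w : ConjTensor L π) :
    tensorInner π (s + t) w = tensorInner π s w + tensorInner π t w := by
  simp [tensorInner]

theorem tensorInner_smul_left (z : ℂ) (t w : ConjTensor L π) :
    tensorInner π (z • t) w = conj z * tensorInner π t w := by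
  simp [tensorInner]

theorem tensor_induction {p : ConjTensor L π → Prop}
    (t : ConjTensor L π) (h0 : p 0) (ht : ∀ e u, p (conjTmul π e u))
    (ha : ∀ s t, p s → p t → p (s + t)) : p t :=
  balanced_induction t h0 (fun e u => ht (ofConj e) u) ha

theorem tensorInner_add_right (w s t : ConjTensor L π) :
    tensorInner π w (s + t) = tensorInner π w s + tensorInner π w t := by
  induction w using tensor_induction with
  | h0 => simp [tensorInner]
  | ht e u => simp [tensorInner_tmul_left]
  | ha a b h1 h2 =>
    simp only [tensorInner_add_left, h1, h2]
    ring

theorem tensorInner_zero_left (w : ConjTensor L π) : tensorInner π 0 w = 0 := by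
  rw [tensorInner, map_zero, map_zero]

theorem tensorInner_zero_right (w : ConjTensor L π) : tensorInner π w 0 = 0 := by
  have := tensorInner_add_right π w 0 0
  simpa using this

theorem tensorInner_conj (t w : ConjTensor L π) :
    conj (tensorInner π w t) = tensorInner π t w := by
  induction t using tensor_induction with
  | h0 => rw [tensorInner_zero_right, tensorInner_zero_left, map_zero]
  | ha a b h1 h2 => simp only [tensorInner_add_left, tensorInner_add_right, map_add, h1, h2]
  | ht e u =>
    induction w using tensor_induction with
    | h0 => rw [tensorInner_zero_right, tensorInner_zero_left, map_zero]
    | ha a b h1 h2 => simp only [tensorInner_add_left, tensorInner_add_right, map_add, h1, h2]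
    | ht e' u' =>
      rw [tensorInner_tmul, tensorInner_tmul, inner_conj_symm, ← star_pair, map_star,
        ContinuousLinearMap.star_eq_adjoint, ContinuousLinearMap.adjoint_inner_left]

theorem tensorInner_sum {ι : Type*} (s : Finset ι) (f : ι → ConjTensor L π)
    (w : ConjTensor L π) :
    tensorInner π (∑ i ∈ s, f i) w = ∑ i ∈ s, tensorInner π (f i) w := by
  simp [tensorInner]

theorem tensorInner_sum_right {ι : Type*} (s : Finset ι) (f : ι → ConjTensor L π)
    (w : ConjTensor L π) :
    tensorInner π w (∑ i ∈ s, f i) = ∑ i ∈ s, tensorInner π w (f i) := by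
  rw [← tensorInner_conj, tensorInner_sum, map_sum]
  simp only [tensorInner_conj]

theorem tensorInner_basis (k k' : Fin n → H) :
    tensorInner π (∑ i, conjTmul π (D.basis.vec i) (k i)) (∑ j, conjTmul π (D.basis.vec j) (k' j)) =
      ∑ i, ∑ j, inner ℂ (k i) (π (metricMatrix D.basis i j) (k' j)) := by
  rw [tensorInner_sum]
  simp only [tensorInner_sum_right, tensorInner_tmul]
  rfl

theorem tensorInner_nonneg (k : Fin n → H) :
    0 ≤ (tensorInner π (∑ i, conjTmul π (D.basis.vec i) (k i))
      (∑ j, conjTmul π (D.basis.vec j) (k j))).re := by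
  obtain ⟨r, hr, hg⟩ := D.root
  have h1 : tensorInner π (∑ i, conjTmul π (D.basis.vec i) (k i))
      (∑ j, conjTmul π (D.basis.vec j) (k j)) =
      ∑ p, inner ℂ (∑ i, π (r p i) (k i)) (∑ j, π (r p j) (k j)) := by
    rw [tensorInner_basis]
    have h4 : ∀ p, (inner ℂ (∑ i, π (r p i) (k i)) (∑ j, π (r p j) (k j)) : ℂ) =
        ∑ i, ∑ j, inner ℂ (π (r p i) (k i)) (π (r p j) (k j)) := by
      intro p
      rw [sum_inner]
      simp only [inner_sum]
    simp only [h4]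
    have h2 : ∀ i j, inner ℂ (k i) (π (metricMatrix D.basis i j) (k j)) =
        ∑ p, inner ℂ (π (r p i) (k i)) (π (r p j) (k j)) := by
      intro i j
      rw [← hg, Matrix.mul_apply, map_sum, sum_apply, inner_sum]
      refine Finset.sum_congr rfl fun p _ => ?_
      have h3 : r i p = star (r p i) := by
        conv_lhs => rw [← hr]
        rfl
      rw [h3, map_mul, map_star, ContinuousLinearMap.star_eq_adjoint,
        mul_apply_eq_comp, ContinuousLinearMap.adjoint_inner_right]
    simp only [h2]
    calc _ = ∑ i, ∑ p, ∑ j, inner ℂ (π (r p i) (k i)) (π (r p j) (k j)) :=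
        Finset.sum_congr rfl fun _ _ => Finset.sum_comm
      _ = _ := Finset.sum_comm
  rw [h1, Complex.re_sum]
  exact Finset.sum_nonneg fun p _ => inner_self_nonneg (𝕜 := ℂ)

/-- `H₁ = C_c(ℝ, L̄ ⊗_A H)`: the functions `x ↦ ∑ \overline{e^i} ⊗ k_i(x)` with `k_i : ℝ → H`
continuous of compact support. -/
def H1 : Submodule ℂ (ℝ → ConjTensor L π) where
  carrier := {v | ∃ k : Fin n → ℝ → H, (∀ i, Continuous (k i) ∧ HasCompactSupport (k i)) ∧
    ∀ x, v x = ∑ i, conjTmul π (D.basis.vec i) (k i x)}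
  add_mem' := by
    rintro v w ⟨k, hk, hv⟩ ⟨l, hl, hw⟩
    refine ⟨fun i x => k i x + l i x, fun i => ⟨(hk i).1.add (hl i).1, (hk i).2.add (hl i).2⟩,
      fun x => ?_⟩
    rw [Pi.add_apply, hv, hw, ← Finset.sum_add_distrib]
    refine Finset.sum_congr rfl fun i _ => ?_
    exact (balancedTmul_add_right _ _ _ _ _).symm
  zero_mem' := by
    refine ⟨fun _ _ => 0, fun i => ⟨continuous_const, HasCompactSupport.zero⟩, fun x => ?_⟩
    refine (Finset.sum_eq_zero fun i _ => ?_).symm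
    exact congrArg Submodule.Quotient.mk (TensorProduct.tmul_zero _ _)
  smul_mem' := by
    rintro z v ⟨k, hk, hv⟩
    refine ⟨fun i x => z • k i x, fun i => ⟨(hk i).1.const_smul z, (hk i).2.smul_left⟩,
      fun x => ?_⟩
    rw [Pi.smul_apply, hv, Finset.smul_sum]
    refine Finset.sum_congr rfl fun i _ => ?_
    exact (balancedTmul_smul_right _ _ _ _ _).symm

/-- `H₀ ⊕ H₁`, with `H₀ = C(ℝ_∞, H)`. -/
def PreH : Type _ := C(OnePoint ℝ, H) × H1 D π

instance : AddCommGroup (D.PreH π) := inferInstanceAs (AddCommGroup (C(OnePoint ℝ, H) × H1 D π))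

instance : Module ℂ (D.PreH π) := inferInstanceAs (Module ℂ (C(OnePoint ℝ, H) × H1 D π))

variable {D π} in
/-- The value `v₀(x)`, `x ∈ ℝ`. -/
def PreH.v0 (v : D.PreH π) (x : ℝ) : H := v.1 (x : OnePoint ℝ)

variable {D π} in
/-- The value `v₁(x)`, `x ∈ ℝ`. -/
def PreH.v1 (v : D.PreH π) (x : ℝ) : ConjTensor L π := v.2.1 x

theorem PreH.v0_add (v w : D.PreH π) (x : ℝ) : (v + w).v0 x = v.v0 x + w.v0 x := rfl
theorem PreH.v1_add (v w : D.PreH π) (x : ℝ) : (v + w).v1 x = v.v1 x + w.v1 x := rfl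
theorem PreH.v0_smul (z : ℂ) (v : D.PreH π) (x : ℝ) : (z • v).v0 x = z • v.v0 x := rfl
theorem PreH.v1_smul (z : ℂ) (v : D.PreH π) (x : ℝ) : (z • v).v1 x = z • v.v1 x := rfl

/-- The integrand of the inner product on `H₀ ⊕ H₁`. -/
def preInnerFun (v w : D.PreH π) (x : ℝ) : ℂ :=
  (inner ℂ (v.v0 x) (w.v0 x) + (x : ℂ) ^ 2 * tensorInner π (v.v1 x) (w.v1 x)) / (1 + (x : ℂ) ^ 2)

theorem integrable_preInnerFun (v w : D.PreH π) : Integrable (D.preInnerFun π v w) := by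
  have hne : ∀ x : ℝ, (1 + (x : ℂ) ^ 2) ≠ 0 := by
    intro x
    have : (1 + x ^ 2 : ℝ) ≠ 0 := by positivity
    exact_mod_cast this
  have hc : ∀ u : D.PreH π, Continuous u.v0 := fun u => u.1.continuous.comp OnePoint.continuous_coe
  have hb : ∀ u : D.PreH π, ∀ x, ‖u.v0 x‖ ≤ ‖u.1‖ := fun u x => u.1.norm_coe_le_norm _
  have h0 : Integrable fun x : ℝ => inner ℂ (v.v0 x) (w.v0 x) * ((1 + x ^ 2)⁻¹ : ℝ) := by
    refine Integrable.bdd_mul (c := ‖v.1‖ * ‖w.1‖) integrable_inv_one_add_sq.ofReal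
      ((hc v).inner (hc w)).aestronglyMeasurable (ae_of_all _ fun x => ?_)
    exact (norm_inner_le_norm _ _).trans (mul_le_mul (hb v x) (hb w x) (norm_nonneg _)
      (norm_nonneg _))
  have h1 : Integrable fun x : ℝ =>
      (x : ℂ) ^ 2 / (1 + (x : ℂ) ^ 2) * tensorInner π (v.v1 x) (w.v1 x) := by
    obtain ⟨k, hk, hv⟩ := v.2.2
    obtain ⟨l, hl, hw⟩ := w.2.2
    have h2 : ∀ x, tensorInner π (v.v1 x) (w.v1 x) =
        ∑ i, ∑ j, inner ℂ (k i x) (π (metricMatrix D.basis i j) (l j x)) := by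
      intro x
      rw [← tensorInner_basis, PreH.v1, PreH.v1, hv, hw]
    simp only [h2, Finset.mul_sum]
    refine integrable_finsetSum _ fun i _ => integrable_finsetSum _ fun j _ => ?_
    refine Continuous.integrable_of_hasCompactSupport ?_ ?_
    · refine Continuous.mul ?_ ?_
      · exact Continuous.div (by fun_prop) (by fun_prop) hne
      · exact (hk i).1.inner ((π _).continuous.comp (hl j).1)
    · refine HasCompactSupport.mul_left ?_
      refine (hk i).2.mono fun x hx => ?_
      rw [Function.mem_support] at hx ⊢
      contrapose! hx
      rw [hx, inner_zero_left]
  refine (h0.add h1).congr (ae_of_all _ fun x => ?_)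
  simp only [Pi.add_apply, preInnerFun]
  push_cast
  field_simp

/-- The positive form
`⟨v, w⟩_{0,1} = ∫ (⟨v₀, w₀⟩₀ + x² ⟨v₁, w₁⟩₁) / (1 + x²) dx` on `H₀ ⊕ H₁`. -/
@[reducible] def preCore : PreInnerProductSpace.Core ℂ (D.PreH π) where
  inner v w := ∫ x, D.preInnerFun π v w x
  conj_inner_symm v w := by
    change conj (∫ x, D.preInnerFun π w v x) = ∫ x, D.preInnerFun π v w x
    rw [← integral_conj]
    refine integral_congr_ae (ae_of_all _ fun x => ?_)
    simp only [preInnerFun, map_div₀, map_add, map_mul, map_pow, Complex.conj_ofReal, map_one,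
      inner_conj_symm, tensorInner_conj]
  re_inner_nonneg v := by
    rw [← integral_re (D.integrable_preInnerFun π v v)]
    refine integral_nonneg fun x => ?_
    obtain ⟨k, hk, hv⟩ := v.2.2
    have h1 : 0 ≤ (tensorInner π (v.v1 x) (v.v1 x)).re := by
      rw [PreH.v1, hv]
      exact D.tensorInner_nonneg π _
    have h0 : 0 ≤ (inner ℂ (v.v0 x) (v.v0 x) : ℂ).re := inner_self_nonneg (𝕜 := ℂ)
    have h2 : D.preInnerFun π v v x = (inner ℂ (v.v0 x) (v.v0 x) +
        ((x ^ 2 : ℝ) : ℂ) * tensorInner π (v.v1 x) (v.v1 x)) / ((1 + x ^ 2 : ℝ) : ℂ) := by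
      simp [preInnerFun]
    change 0 ≤ (D.preInnerFun π v v x).re
    rw [h2, Complex.div_ofReal_re, Complex.add_re, Complex.re_ofReal_mul]
    positivity
  add_left u v w := by
    change ∫ x, D.preInnerFun π (u + v) w x = _ + _
    rw [← integral_add (D.integrable_preInnerFun π u w) (D.integrable_preInnerFun π v w)]
    refine integral_congr_ae (ae_of_all _ fun x => ?_)
    simp only [preInnerFun, PreH.v0_add, PreH.v1_add, inner_add_left, tensorInner_add_left]
    ring
  smul_left v w z := by
    change ∫ x, D.preInnerFun π (z • v) w x = conj z * ∫ x, D.preInnerFun π v w x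
    rw [← integral_const_mul]
    refine integral_congr_ae (ae_of_all _ fun x => ?_)
    simp only [preInnerFun, PreH.v0_smul, PreH.v1_smul, inner_smul_left, tensorInner_smul_left]
    ring

instance : SeminormedAddCommGroup (D.PreH π) :=
  @InnerProductSpace.Core.toSeminormedAddCommGroup ℂ _ _ _ _ (D.preCore π)

instance : InnerProductSpace ℂ (D.PreH π) := InnerProductSpace.ofCore (D.preCore π)

/-- The Hilbert space `H_{0,1}`: the completion of `H₀ ⊕ H₁` for the inner product
`∫ (⟨v₀, w₀⟩₀ + x² ⟨v₁, w₁⟩₁) / (1 + x²) dx`. -/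
abbrev H01 : Type _ := UniformSpace.Completion (D.PreH π)

/-- `w = f ▷ v`: `w₀ = f₀ ▷ v₀ + x² ⟨f₁, v₁⟩` and `w₁ = \overline{f₁*} ⊗ v₀ + f₀ ▷ v₁`, where
`⟨f₁, ē ⊗ u⟩ = ⟨f₁, ē⟩ ▷ u`. -/
def IsAction (f : D.BL) (v w : D.PreH π) : Prop :=
  (∀ x, w.v0 x = π (f.f0 x) (v.v0 x) + (x : ℂ) ^ 2 • pairAct π (v.v1 x) (f.f1 x)) ∧
  ∀ x, w.v1 x = conjTmul π (D.invol.st (f.f1 x)) (v.v0 x) + leftAct π (f.f0 x) (v.v1 x)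

/-! ### The three classes of functions -/

/-- `f₁ = ∑ f_{1,i} e^i` with each `f_{1,i} : ℝ → A` continuous of compact support. -/
def IsCompactOdd (f : D.BL) : Prop :=
  ∃ c : Fin n → ℝ → A, (∀ i, Continuous (c i) ∧ HasCompactSupport (c i)) ∧
    ∀ x, f.f1 x = ∑ i, c i x • D.basis.vec i

/-- Case (a): `f₀ ∈ C₀(ℝ, A)`. -/
def vanishingFunctions : Set D.BL :=
  {f | D.IsCompactOdd f ∧ ∃ F : C₀(ℝ, A), ∀ x, f.f0 x = F x}

/-- Case (b): `f₀ ∈ C₀(ℝ, A) + ℂ 1`. -/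
def thomFunctions : Set D.BL :=
  {f | ∃ g ∈ D.vanishingFunctions, ∃ z : ℂ, f = z • 1 + g}

/-- Case (c): `f₀ ∈ C(ℝ_∞, A)`. -/
def circleFunctions : Set D.BL :=
  {f | D.IsCompactOdd f ∧ ∃ F : C(OnePoint ℝ, A), ∀ x : ℝ, f.f0 x = F x}

end HermitianLine

end Line

end

/-!
Every `f` in `B_c` acts fibrewise on `H₀ ⊕ H₁`, and the proof rests on fibrewise identities and
estimates over a point `x ∈ ℝ`, integrated afterwards.

*Subalgebras.* The condition on `f₁` says that `f₁` is in the space `compactSections` of functions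
`x ↦ ∑ c_i(x) e^i`.  Everything about it reduces to the continuity of the maps `a ↦ e_j(e.a)`,
which is the boundedness hypothesis on `e_i(e^j.a)`: it makes `compactSections` stable under
multiplication on either side by continuous functions and under the star operation.

*The form on `L̄ ⊗_A H`.* The Hermitian square root of `g^{ij}` makes it positive semidefinite.
The left action of `A` is then a `*`-action, hence contractive (`tensorInner_leftAct_self_le`),
and the pairing with `f ∈ L` satisfies a Cauchy–Schwarz inequality (`norm_pairAct_sq_le`).

*The representation.* `v ↦ f ▷ v` is multiplicative by the identity
`e.⟨f, \overline{h*}⟩ = ⟨e, \overline{f*}⟩.h` that line modules with star compatible metric satisfy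
(`conjTmul_pairAct`), and `f*` acts as its formal adjoint (`IsAction.preInnerFun_eq`).  The two
inequalities give the bound with constant `√2` (`IsAction.preInnerFun_le`), so the action extends
to the completion.

*The closures.* The closure of the image of `B_a` has no unit: a unit would fix the vectors
`(ψ u, 0)` with `ψ` a bump function, however far out, but it is a norm limit of operators `ρ(g)`
with `g` vanishing at infinity (`not_exists_unit_vanishingClosure`).  In particular it does not
contain `1`, so its unitization embeds in the operators.  The image is closed, being the sum of a
closed subspace and a line, and hence is the closure of the image of `B_b`
(`adjoin_vanishingClosure`).
-/

noncomputable section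

set_option linter.unusedSectionVars false

namespace HermitianLine

/-! ### Sections of compact support -/

section Sections

variable {A : Type*} [CStarAlgebra A] [PartialOrder A] [StarOrderedRing A]
  {L : Type*} [NormedAddCommGroup L] [Module ℂ L] [Module A L] [Module Aᵐᵒᵖ L]
  [SMulCommClass A Aᵐᵒᵖ L] [IsScalarTower ℂ A L] [IsScalarTower ℂ Aᵐᵒᵖ L]
  [CStarModule A L] {n : ℕ} (D : HermitianLine A L n)

/-- The boundedness hypothesis on the elements `e^i` extends to all of `L` through the dual basis. -/
theorem exists_coord_bound (j : Fin n) (e : L) :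
    ∃ K : ℝ, ∀ a : A, ‖D.basis.covec j (op a • e)‖ ≤ K * ‖a‖ := by
  obtain ⟨M, hM, hb⟩ := D.bounded
  refine ⟨∑ i, ‖D.basis.covec i e‖ * M, fun a => ?_⟩
  have h : op a • e = ∑ i, D.basis.covec i e • op a • D.basis.vec i := by
    conv_lhs => rw [← D.basis.expand e, Finset.smul_sum]
    exact Finset.sum_congr rfl fun i _ => (smul_comm _ _ _).symm
  rw [h, map_sum, Finset.sum_mul]
  refine (norm_sum_le _ _).trans (Finset.sum_le_sum fun i _ => ?_)
  rw [map_smul, smul_eq_mul, mul_assoc]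
  exact (norm_mul_le _ _).trans (by gcongr; exact hb j i a)

/-- The `j`-th coefficient `e_j(e.a)` of `e.a` as a continuous linear function of `a`. -/
def coord (j : Fin n) (e : L) : A →L[ℂ] A :=
  LinearMap.mkContinuousOfExistsBound
    { toFun := fun a => D.basis.covec j (op a • e)
      map_add' := fun a b => by rw [op_add, add_smul, map_add]
      map_smul' := fun z a => by
        rw [op_csmul, ← algebraMap_smul A z (op a • e), map_smul, algebraMap_smul,
          RingHom.id_apply] }
    (D.exists_coord_bound j e)

theorem op_smul_eq_sum_coord (a : A) (e : L) :
    op a • e = ∑ j, D.coord j e a • D.basis.vec j :=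
  (D.basis.expand (op a • e)).symm

/-- `C_c(ℝ, A) ⊗_A L`: the functions `x ↦ ∑ c_i(x) e^i` with `c_i : ℝ → A` continuous of compact
support. -/
def compactSections : Submodule ℂ (ℝ → L) where
  carrier := {φ | ∃ c : Fin n → ℝ → A, (∀ i, Continuous (c i) ∧ HasCompactSupport (c i)) ∧
    ∀ x, φ x = ∑ i, c i x • D.basis.vec i}
  add_mem' := by
    rintro φ ψ ⟨c, hc, hφ⟩ ⟨d, hd, hψ⟩
    refine ⟨fun i x => c i x + d i x, fun i => ⟨(hc i).1.add (hd i).1, (hc i).2.add (hd i).2⟩,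
      fun x => ?_⟩
    simp only [Pi.add_apply, hφ, hψ, add_smul, Finset.sum_add_distrib]
  zero_mem' := ⟨fun _ _ => 0, fun i => ⟨continuous_const, HasCompactSupport.zero⟩,
    fun x => by simp⟩
  smul_mem' := by
    rintro z φ ⟨c, hc, hφ⟩
    refine ⟨fun i x => z • c i x, fun i => ⟨(hc i).1.const_smul z,
      (hc i).2.comp_left (smul_zero z)⟩, fun x => ?_⟩
    simp only [Pi.smul_apply, hφ, Finset.smul_sum, smul_assoc]

theorem isCompactOdd_iff (f : D.BL) : D.IsCompactOdd f ↔ f.f1 ∈ D.compactSections := Iff.rfl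

theorem sum_mem_compactSections {ι : Type*} [Fintype ι] {φ : ι → ℝ → L}
    (h : ∀ i, φ i ∈ D.compactSections) : (fun x => ∑ i, φ i x) ∈ D.compactSections := by
  have := D.compactSections.sum_mem (t := Finset.univ) fun i _ => h i
  convert this using 1
  ext x
  simp

/-- The sections `x ↦ c(x) e b(x)` lie in `C_c(ℝ, A) ⊗_A L` if one of the continuous functions
`c`, `b` has compact support. -/
theorem smul_op_smul_mem_compactSections {c b : ℝ → A} (hc : Continuous c) (hb : Continuous b)
    (h : HasCompactSupport c ∨ HasCompactSupport b) (e : L) :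
    (fun x => c x • op (b x) • e) ∈ D.compactSections := by
  refine ⟨fun j x => c x * D.coord j e (b x), fun j => ⟨by fun_prop, ?_⟩, fun x => ?_⟩
  · rcases h with h | h
    · exact h.mul_right
    · exact (h.comp_left (map_zero (D.coord j e))).mul_left
  · change c x • op (b x) • e = _
    rw [D.op_smul_eq_sum_coord (b x) e, Finset.smul_sum]
    exact Finset.sum_congr rfl fun j _ => (mul_smul _ _ _).symm

theorem smul_mem_compactSections {c : ℝ → A} (hc : Continuous c) {φ : ℝ → L}
    (hφ : φ ∈ D.compactSections) : (fun x => c x • φ x) ∈ D.compactSections := by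
  obtain ⟨d, hd, h⟩ := hφ
  refine ⟨fun i x => c x * d i x, fun i => ⟨hc.mul (hd i).1, (hd i).2.mul_left⟩, fun x => ?_⟩
  simp only [h, Finset.smul_sum, mul_smul]

theorem op_smul_mem_compactSections {b : ℝ → A} (hb : Continuous b) {φ : ℝ → L}
    (hφ : φ ∈ D.compactSections) : (fun x => op (b x) • φ x) ∈ D.compactSections := by
  obtain ⟨c, hc, h⟩ := hφ
  have h1 : (fun x => op (b x) • φ x) =
      fun x => ∑ i, c i x • op (b x) • D.basis.vec i := by
    funext x
    rw [h, Finset.smul_sum]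
    exact Finset.sum_congr rfl fun i _ => (smul_comm _ _ _).symm
  rw [h1]
  exact D.sum_mem_compactSections fun i =>
    D.smul_op_smul_mem_compactSections (hc i).1 hb (Or.inl (hc i).2) _

theorem st_sum {ι : Type*} (s : Finset ι) (g : ι → L) :
    D.invol.st (∑ i ∈ s, g i) = ∑ i ∈ s, D.invol.st (g i) :=
  map_sum (AddMonoidHom.mk' D.invol.st D.invol.st_add) g s

theorem st_mem_compactSections {φ : ℝ → L} (hφ : φ ∈ D.compactSections) :
    (fun x => D.invol.st (φ x)) ∈ D.compactSections := by
  obtain ⟨c, hc, h⟩ := hφ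
  have h1 : (fun x => D.invol.st (φ x)) =
      fun x => ∑ i, (1 : A) • op (star (c i x)) • D.invol.st (D.basis.vec i) := by
    funext x
    rw [h, D.st_sum]
    exact Finset.sum_congr rfl fun i _ => by rw [D.invol.st_smul, one_smul]
  rw [h1]
  exact D.sum_mem_compactSections fun i =>
    D.smul_op_smul_mem_compactSections continuous_const (hc i).1.star
      (Or.inr ((hc i).2.comp_left (star_zero A))) _

theorem pair_sum_left {ι : Type*} (s : Finset ι) (g : ι → L) (e : L) :
    pair A (∑ i ∈ s, g i) e = ∑ i ∈ s, pair A (g i) e :=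
  CStarModule.inner_sum_right

theorem pair_sum_right {ι : Type*} (s : Finset ι) (g : ι → L) (e : L) :
    pair A e (∑ i ∈ s, g i) = ∑ i ∈ s, pair A e (g i) :=
  CStarModule.inner_sum_left

theorem continuous_pair {φ ψ : ℝ → L} (hφ : φ ∈ D.compactSections)
    (hψ : ψ ∈ D.compactSections) :
    Continuous (fun x => pair A (φ x) (ψ x)) ∧ HasCompactSupport fun x => pair A (φ x) (ψ x) := by
  obtain ⟨c, hc, h⟩ := hφ
  obtain ⟨d, hd, h'⟩ := hψ
  have h1 : (fun x => pair A (φ x) (ψ x)) = fun x =>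
      ∑ i, c i x * ∑ j, pair A (D.basis.vec i) (D.basis.vec j) * star (d j x) := by
    funext x
    simp only [h, h', pair_sum_left, pair_smul_left]
    simp only [pair_sum_right, pair_smul_right]
  have hcc := fun i => (hc i).1
  have hdc := fun i => (hd i).1
  refine ⟨by rw [h1]; fun_prop, ?_⟩
  rw [h1]
  have h2 : HasCompactSupport (fun x => fun i => c i x) := by
    refine HasCompactSupport.intro (isCompact_iUnion fun i => (hc i).2.isCompact) fun x hx => ?_
    simp only [Set.mem_iUnion, not_exists] at hx
    exact funext fun i => image_eq_zero_of_notMem_tsupport (hx i)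
  refine h2.mono fun x hx => ?_
  rw [Function.mem_support] at hx ⊢
  contrapose! hx
  simp [show ∀ i, c i x = 0 from congrFun hx]

/-! ### The three classes of functions are star subalgebras -/

/-- A continuous function on `ℝ` with a limit at infinity extends to the one-point
compactification. -/
theorem exists_onePoint_extension {E : Type*} [TopologicalSpace E] {g : ℝ → E}
    (hg : Continuous g) {y : E} (h : Filter.Tendsto g (Filter.cocompact ℝ) (nhds y)) :
    ∃ G : C(OnePoint ℝ, E), ∀ x : ℝ, G x = g x :=
  ⟨OnePoint.continuousMapMk ⟨g, hg⟩ y (by simpa [Filter.coclosedCompact_eq_cocompact] using h),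
    fun _ => rfl⟩

theorem exists_onePoint_extension_of_hasCompactSupport {E : Type*} [TopologicalSpace E] [Zero E]
    {g : ℝ → E} (hg : Continuous g) (h : HasCompactSupport g) :
    ∃ G : C(OnePoint ℝ, E), ∀ x : ℝ, G x = g x :=
  exists_onePoint_extension hg h.is_zero_at_infty

theorem continuous_f0_of_mem_circleFunctions {f : D.BL} (hf : f ∈ D.circleFunctions) :
    Continuous f.f0 := by
  obtain ⟨-, F, hF⟩ := hf
  rw [show f.f0 = fun x : ℝ => F x from funext hF]
  exact F.continuous.comp OnePoint.continuous_coe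

theorem vanishingFunctions_subset_circleFunctions :
    D.vanishingFunctions ⊆ D.circleFunctions := by
  rintro f ⟨h1, F, hF⟩
  obtain ⟨G, hG⟩ := exists_onePoint_extension F.continuous F.zero_at_infty'
  exact ⟨h1, G, fun x => (hF x).trans (hG x).symm⟩

theorem mul_snd_mem {f g : D.BL} (hf : f ∈ D.circleFunctions) (hg : g ∈ D.circleFunctions) :
    D.IsCompactOdd (f * g) :=
  D.compactSections.add_mem
    (D.smul_mem_compactSections (D.continuous_f0_of_mem_circleFunctions hf) hg.1)
    (D.op_smul_mem_compactSections (D.continuous_f0_of_mem_circleFunctions hg) hf.1)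

theorem mul_fst_correction {f g : D.BL} (hf : D.IsCompactOdd f) (hg : D.IsCompactOdd g) :
    Continuous (fun x : ℝ => (x : ℂ) ^ 2 • pair A (f.f1 x) (D.invol.st (g.f1 x))) ∧
    HasCompactSupport (fun x : ℝ => (x : ℂ) ^ 2 • pair A (f.f1 x) (D.invol.st (g.f1 x))) := by
  obtain ⟨h1, h2⟩ := D.continuous_pair hf (D.st_mem_compactSections hg)
  exact ⟨(by fun_prop : Continuous fun x : ℝ => (x : ℂ) ^ 2).smul h1,
    h2.mono fun x hx hp => hx (by simp only [hp, smul_zero])⟩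

/-- The functions of class (a) as a star subalgebra of `B_L`. -/
def vanishingSubalgebra : NonUnitalStarSubalgebra ℂ D.BL where
  carrier := D.vanishingFunctions
  add_mem' := by
    rintro f g ⟨hf, F, hF⟩ ⟨hg, G, hG⟩
    exact ⟨D.compactSections.add_mem hf hg, F + G, fun x => by
      rw [add_fst, hF, hG]; rfl⟩
  zero_mem' := ⟨D.compactSections.zero_mem, 0, fun _ => rfl⟩
  mul_mem' := by
    intro f g hf hg
    refine ⟨D.mul_snd_mem (D.vanishingFunctions_subset_circleFunctions hf)
      (D.vanishingFunctions_subset_circleFunctions hg), ?_⟩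
    obtain ⟨hf, F, hF⟩ := hf
    obtain ⟨hg, G, hG⟩ := hg
    obtain ⟨hc, hs⟩ := D.mul_fst_correction hf hg
    refine ⟨F * G + ⟨⟨_, hc⟩, hs.is_zero_at_infty⟩, fun x => ?_⟩
    rw [mul_fst, hF, hG]
    rfl
  smul_mem' := by
    rintro z f ⟨hf, F, hF⟩
    exact ⟨D.compactSections.smul_mem z hf, z • F, fun x => by rw [smul_fst, hF]; rfl⟩
  star_mem' := by
    rintro f ⟨hf, F, hF⟩
    exact ⟨D.st_mem_compactSections hf, star F, fun x => by rw [star_fst, hF]; rfl⟩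

/-- The functions of class (b) as a star subalgebra of `B_L`. -/
def thomSubalgebra : StarSubalgebra ℂ D.BL where
  carrier := D.thomFunctions
  add_mem' := by
    rintro _ _ ⟨g, hg, z, rfl⟩ ⟨g', hg', z', rfl⟩
    exact ⟨g + g', D.vanishingSubalgebra.add_mem hg hg', z + z', by rw [add_smul]; abel⟩
  mul_mem' := by
    rintro _ _ ⟨g, hg, z, rfl⟩ ⟨g', hg', z', rfl⟩
    refine ⟨z • g' + z' • g + g * g', D.vanishingSubalgebra.add_mem
      (D.vanishingSubalgebra.add_mem (D.vanishingSubalgebra.smul_mem z hg')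
        (D.vanishingSubalgebra.smul_mem z' hg)) (D.vanishingSubalgebra.mul_mem hg hg'),
      z * z', ?_⟩
    simp only [add_mul, mul_add, smul_mul_assoc, mul_smul_comm, one_mul, mul_one, smul_smul,
      smul_add]
    rw [mul_comm z' z]
    abel
  algebraMap_mem' z :=
    ⟨0, D.vanishingSubalgebra.zero_mem, z, by rw [add_zero, Algebra.algebraMap_eq_smul_one]⟩
  star_mem' := by
    rintro _ ⟨g, hg, z, rfl⟩
    exact ⟨star g, star_mem (s := D.vanishingSubalgebra) hg, star z, by
      rw [star_add, star_smul, star_one]⟩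

/-- The functions of class (c) as a star subalgebra of `B_L`. -/
def circleSubalgebra : StarSubalgebra ℂ D.BL where
  carrier := D.circleFunctions
  add_mem' := by
    rintro f g ⟨hf, F, hF⟩ ⟨hg, G, hG⟩
    exact ⟨D.compactSections.add_mem hf hg, F + G, fun x => by
      rw [add_fst, hF, hG]; rfl⟩
  mul_mem' := by
    intro f g hf hg
    refine ⟨D.mul_snd_mem hf hg, ?_⟩
    obtain ⟨hf, F, hF⟩ := hf
    obtain ⟨hg, G, hG⟩ := hg
    obtain ⟨hc, hs⟩ := D.mul_fst_correction hf hg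
    obtain ⟨K, hK⟩ := exists_onePoint_extension_of_hasCompactSupport hc hs
    refine ⟨F * G + K, fun x => ?_⟩
    rw [mul_fst, hF, hG, ContinuousMap.add_apply, hK]
    rfl
  algebraMap_mem' z := by
    refine ⟨?_, ContinuousMap.const _ (z • 1), fun x => ?_⟩
    · rw [isCompactOdd_iff]
      convert D.compactSections.zero_mem
      rw [Algebra.algebraMap_eq_smul_one]
      exact funext fun x => smul_zero z
    · rw [Algebra.algebraMap_eq_smul_one]
      rfl
  star_mem' := by
    rintro f ⟨hf, F, hF⟩
    exact ⟨D.st_mem_compactSections hf, star F, fun x => by rw [star_fst, hF]; rfl⟩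

end Sections

/-! ### The semi-inner product on `L̄ ⊗_A H` -/

section Tensor

variable {A : Type*} [CStarAlgebra A] [PartialOrder A] [StarOrderedRing A]
  {L : Type*} [NormedAddCommGroup L] [Module ℂ L] [Module A L] [Module Aᵐᵒᵖ L]
  [SMulCommClass A Aᵐᵒᵖ L] [IsScalarTower ℂ A L] [IsScalarTower ℂ Aᵐᵒᵖ L]
  [CStarModule A L] {n : ℕ}
  {H : Type*} [NormedAddCommGroup H] [InnerProductSpace ℂ H] [CompleteSpace H]
  (π : A →⋆ₐ[ℂ] (H →L[ℂ] H))

theorem conjTmul_add_left (e e' : L) (u : H) :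
    conjTmul π (e + e') u = conjTmul π e u + conjTmul π e' u :=
  balancedTmul_add_left _ _ (toConj e) (toConj e') u

theorem conjTmul_add_right (e : L) (u u' : H) :
    conjTmul π e (u + u') = conjTmul π e u + conjTmul π e u' :=
  balancedTmul_add_right _ _ _ _ _

theorem conjTmul_smul_right (z : ℂ) (e : L) (u : H) :
    conjTmul π e (z • u) = z • conjTmul π e u :=
  balancedTmul_smul_right _ _ _ _ _

theorem conjTmul_csmul_left (z : ℂ) (e : L) (u : H) :
    conjTmul π (z • e) u = conj z • conjTmul π e u := by
  have h := balancedTmul_smul_left (fun (a : A) e => toConj (star a • ofConj e))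
    (fun a (u : H) => π a u) (conj z) (toConj e) u
  rw [show conj z • toConj e = toConj (z • e) by
    change conj (conj z) • e = z • e
    rw [Complex.conj_conj]] at h
  exact h

theorem conjTmul_zero_left (u : H) : conjTmul π (0 : L) u = 0 := by
  simpa using conjTmul_csmul_left π 0 (0 : L) u

theorem conjTmul_zero_right (e : L) : conjTmul π e (0 : H) = 0 := by
  simpa using conjTmul_smul_right π 0 e (0 : H)

theorem conjTmul_smul_left (a : A) (e : L) (u : H) :
    conjTmul π (a • e) u = conjTmul π e (π (star a) u) := by
  have h := balancedTmul_rel (fun (a : A) e => toConj (star a • ofConj e))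
    (fun a (u : H) => π a u) (star a) (toConj e) u
  rw [star_star] at h
  exact h

theorem conjTmul_sum_left {ι : Type*} (s : Finset ι) (g : ι → L) (u : H) :
    conjTmul π (∑ i ∈ s, g i) u = ∑ i ∈ s, conjTmul π (g i) u :=
  map_sum (AddMonoidHom.mk' (fun e : L => conjTmul π e u)
    fun e e' => conjTmul_add_left π e e' u) g s

theorem conjTmul_eq_sum (D : HermitianLine A L n) (e : L) (u : H) :
    conjTmul π e u = ∑ i, conjTmul π (D.basis.vec i) (π (star (D.basis.covec i e)) u) := by
  conv_lhs => rw [← D.basis.expand e, conjTmul_sum_left]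
  exact Finset.sum_congr rfl fun i _ => conjTmul_smul_left π _ _ _

/-- The dual basis makes every tensor a combination `∑ \overline{e^i} ⊗ k_i`. -/
theorem exists_eq_sum_conjTmul (D : HermitianLine A L n) (t : ConjTensor L π) :
    ∃ k : Fin n → H, t = ∑ i, conjTmul π (D.basis.vec i) (k i) := by
  induction t using tensor_induction with
  | h0 => exact ⟨0, by simp [conjTmul_zero_right]⟩
  | ht e u => exact ⟨_, D.conjTmul_eq_sum π e u⟩
  | ha s t hs ht =>
    obtain ⟨k, rfl⟩ := hs
    obtain ⟨l, rfl⟩ := ht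
    exact ⟨k + l, by simp only [Pi.add_apply, conjTmul_add_right, Finset.sum_add_distrib]⟩

theorem tensorInner_self_nonneg (D : HermitianLine A L n) (t : ConjTensor L π) :
    0 ≤ (tensorInner π t t).re := by
  obtain ⟨k, rfl⟩ := D.exists_eq_sum_conjTmul π t
  exact D.tensorInner_nonneg π k

/-- The form on `L̄ ⊗_A H` as a positive semidefinite inner product. -/
@[reducible] def tensorCore (D : HermitianLine A L n) :
    PreInnerProductSpace.Core ℂ (ConjTensor L π) where
  inner := tensorInner π
  conj_inner_symm t w := tensorInner_conj π t w
  re_inner_nonneg := D.tensorInner_self_nonneg π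
  add_left := tensorInner_add_left π
  smul_left t w z := tensorInner_smul_left π z t w

theorem norm_tensorInner_sq_le (D : HermitianLine A L n) (t w : ConjTensor L π) :
    ‖tensorInner π t w‖ ^ 2 ≤ (tensorInner π t t).re * (tensorInner π w w).re := by
  have h := @InnerProductSpace.Core.inner_mul_inner_self_le ℂ _ _ _ _ (D.tensorCore π) t w
  refine le_trans (le_of_eq ?_) h
  change _ = ‖tensorInner π t w‖ * ‖tensorInner π w t‖
  rw [← tensorInner_conj π w t, RCLike.norm_conj, sq]

theorem tensorInner_sub_right (s t w : ConjTensor L π) :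
    tensorInner π w (s - t) = tensorInner π w s - tensorInner π w t := by
  have h := tensorInner_add_right π w (s - t) t
  rw [sub_add_cancel] at h
  rw [h, add_sub_cancel_right]

theorem leftAct_add (a b : A) (t : ConjTensor L π) :
    leftAct π (a + b) t = leftAct π a t + leftAct π b t := by
  induction t using tensor_induction with
  | h0 => simp
  | ht e u => simp only [leftAct_tmul, star_add, op_add, add_smul, conjTmul_add_left]
  | ha s t hs ht => simp only [map_add, hs, ht]; abel

theorem leftAct_csmul (z : ℂ) (a : A) (t : ConjTensor L π) :
    leftAct π (z • a) t = z • leftAct π a t := by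
  induction t using tensor_induction with
  | h0 => simp
  | ht e u =>
    simp only [leftAct_tmul, star_smul, op_csmul, conjTmul_csmul_left]
    simp
  | ha s t hs ht => simp only [map_add, hs, ht, smul_add]

theorem leftAct_mul (a b : A) (t : ConjTensor L π) :
    leftAct π (a * b) t = leftAct π a (leftAct π b t) := by
  induction t using tensor_induction with
  | h0 => simp
  | ht e u => simp only [leftAct_tmul, star_mul, op_mul, mul_smul]
  | ha s t hs ht => simp only [map_add, hs, ht]

theorem leftAct_one (t : ConjTensor L π) : leftAct π 1 t = t := by
  induction t using tensor_induction with
  | h0 => simp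
  | ht e u => simp only [leftAct_tmul, star_one, op_one, one_smul]
  | ha s t hs ht => simp only [map_add, hs, ht]

theorem tensorInner_leftAct (D : HermitianLine A L n) (a : A) (t w : ConjTensor L π) :
    tensorInner π (leftAct π a t) w = tensorInner π t (leftAct π (star a) w) := by
  induction t using tensor_induction with
  | h0 => rw [map_zero, tensorInner_zero_left, tensorInner_zero_left]
  | ha s t hs ht => simp only [map_add, tensorInner_add_left, hs, ht]
  | ht e u =>
    induction w using tensor_induction with
    | h0 => rw [map_zero, tensorInner_zero_right, tensorInner_zero_right]
    | ha s t hs ht => simp only [map_add, tensorInner_add_right, hs, ht]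
    | ht e' u' =>
      rw [leftAct_tmul, leftAct_tmul, tensorInner_tmul, tensorInner_tmul,
        pair_op_smul_left D.metric]

/-- The left action of `A` on `L̄ ⊗_A H` is contractive: `‖a‖² - a* a = b* b` for some `b`. -/
theorem tensorInner_leftAct_self_le (D : HermitianLine A L n) (a : A) (t : ConjTensor L π) :
    (tensorInner π (leftAct π a t) (leftAct π a t)).re ≤ ‖a‖ ^ 2 * (tensorInner π t t).re := by
  have h : 0 ≤ algebraMap ℝ A (‖a‖ ^ 2) - star a * a := by
    have := CStarAlgebra.star_mul_le_algebraMap_norm_sq (a := a)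
    exact sub_nonneg.2 this
  obtain ⟨b, hb⟩ := CStarAlgebra.nonneg_iff_eq_star_mul_self.1 h
  have h1 : star a * a = (((‖a‖ ^ 2 : ℝ) : ℂ) • (1 : A)) - star b * b := by
    rw [← hb, Algebra.algebraMap_eq_smul_one, Complex.coe_smul]
    abel
  have h2 : leftAct π (star a * a) t =
      ((‖a‖ ^ 2 : ℝ) : ℂ) • t - leftAct π (star b) (leftAct π b t) := by
    rw [eq_sub_iff_add_eq, ← leftAct_mul, ← leftAct_add, h1, sub_add_cancel, leftAct_csmul,
      leftAct_one]
  have h3 : tensorInner π (leftAct π a t) (leftAct π a t) =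
      ((‖a‖ ^ 2 : ℝ) : ℂ) * tensorInner π t t -
        tensorInner π (leftAct π b t) (leftAct π b t) := by
    rw [D.tensorInner_leftAct, ← leftAct_mul, h2, tensorInner_sub_right,
      ← D.tensorInner_leftAct, ← tensorInner_conj π t (_ • t), tensorInner_smul_left, map_mul,
      Complex.conj_conj, tensorInner_conj]
  rw [h3, Complex.sub_re, Complex.re_ofReal_mul]
  linarith [D.tensorInner_self_nonneg π (leftAct π b t)]

theorem norm_apply_le (a : A) (u : H) : ‖π a u‖ ≤ ‖a‖ * ‖u‖ :=
  ((π a).le_opNorm u).trans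
    (mul_le_mul_of_nonneg_right (NonUnitalStarAlgHom.norm_apply_le π a) (norm_nonneg u))

theorem tensorInner_tmul_self_le (e : L) (u : H) :
    (tensorInner π (conjTmul π e u) (conjTmul π e u)).re ≤ ‖pair A e e‖ * ‖u‖ ^ 2 := by
  rw [tensorInner_tmul]
  refine (Complex.re_le_norm _).trans ((norm_inner_le_norm _ _).trans ?_)
  calc _ ≤ ‖u‖ * (‖pair A e e‖ * ‖u‖) := by gcongr; exact norm_apply_le π _ _
    _ = _ := by ring

/-- The Cauchy–Schwarz inequality `‖⟨f, t⟩‖² ≤ ‖⟨f, f̄⟩‖ ⟨t, t⟩₁` for the pairing of `L` with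
`L̄ ⊗_A H`. -/
theorem norm_pairAct_sq_le (D : HermitianLine A L n) (t : ConjTensor L π) (f : L) :
    ‖pairAct π t f‖ ^ 2 ≤ ‖pair A f f‖ * (tensorInner π t t).re := by
  set h := pairAct π t f with hh
  have hT := D.tensorInner_self_nonneg π t
  rcases (norm_nonneg h).eq_or_lt with h0 | h0
  · rw [← h0, zero_pow two_ne_zero]; positivity
  have h1 : ‖tensorInner π (conjTmul π f h) t‖ = ‖h‖ ^ 2 := by
    rw [tensorInner_tmul_left, ← hh, inner_self_eq_norm_sq_to_K]
    simp
  have h2 := D.norm_tensorInner_sq_le π (conjTmul π f h) t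
  rw [h1] at h2
  have h3 : (‖h‖ ^ 2) ^ 2 ≤ (‖pair A f f‖ * (tensorInner π t t).re) * ‖h‖ ^ 2 :=
    h2.trans ((mul_le_mul_of_nonneg_right (tensorInner_tmul_self_le π f h) hT).trans
      (le_of_eq (by ring)))
  rw [sq (‖h‖ ^ 2)] at h3
  exact le_of_mul_le_mul_right h3 (by positivity)

theorem pairAct_op_smul (D : HermitianLine A L n) (a : A) (t : ConjTensor L π) (f : L) :
    pairAct π t (op a • f) = pairAct π (leftAct π a t) f := by
  induction t using tensor_induction with
  | h0 => simp
  | ht e u => rw [leftAct_tmul, pairAct_tmul, pairAct_tmul, pair_op_smul_left D.metric]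
  | ha s t hs ht => simp only [map_add, Pi.add_apply, hs, ht]

/-- The form of the identity `e.⟨f, \overline{h*}⟩ = ⟨e, \overline{f*}⟩.h` that acts on
`L̄ ⊗_A H`. -/
theorem conjTmul_pairAct (D : HermitianLine A L n) (f g : L) (t : ConjTensor L π) :
    conjTmul π (D.invol.st f) (pairAct π t g) =
      leftAct π (pair A f (D.invol.st g)) t := by
  induction t using tensor_induction with
  | h0 => simp [conjTmul_zero_right]
  | ht e u =>
    have h := D.triple e (D.invol.st g) (D.invol.st f)
    rw [D.invol.st_st, D.invol.st_st] at h
    rw [pairAct_tmul, leftAct_tmul, star_pair, h, conjTmul_smul_left, star_pair]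
  | ha s t hs ht => simp only [map_add, Pi.add_apply, conjTmul_add_right, hs, ht]

theorem inner_pairAct (t : ConjTensor L π) (f : L) (u : H) :
    inner ℂ (pairAct π t f) u = tensorInner π t (conjTmul π f u) := by
  rw [← inner_conj_symm, ← tensorInner_tmul_left, tensorInner_conj]

end Tensor

/-! ### The action on `H₀ ⊕ H₁` -/

section Action

variable {A : Type*} [CStarAlgebra A] [PartialOrder A] [StarOrderedRing A]
  {L : Type*} [NormedAddCommGroup L] [Module ℂ L] [Module A L] [Module Aᵐᵒᵖ L]
  [SMulCommClass A Aᵐᵒᵖ L] [IsScalarTower ℂ A L] [IsScalarTower ℂ Aᵐᵒᵖ L]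
  [CStarModule A L] {n : ℕ} (D : HermitianLine A L n)
  {H : Type*} [NormedAddCommGroup H] [InnerProductSpace ℂ H] [CompleteSpace H]
  (π : A →⋆ₐ[ℂ] (H →L[ℂ] H))

theorem continuous_rep_apply {T : Type*} [TopologicalSpace T] {a : T → A} {k : T → H}
    (ha : Continuous a) (hk : Continuous k) : Continuous fun x => π (a x) (k x) :=
  ((map_continuous π).comp ha).clm_apply hk

theorem sum_mem_H1 {ι : Type*} [Fintype ι] {φ : ι → ℝ → ConjTensor L π}
    (h : ∀ i, φ i ∈ H1 D π) : (fun x => ∑ i, φ i x) ∈ H1 D π := by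
  have := (H1 D π).sum_mem (t := Finset.univ) fun i _ => h i
  convert this using 1
  ext x
  simp

/-- The functions `x ↦ \overline{e b(x)} ⊗ k(x)` lie in `H₁` if one of the continuous functions
`b`, `k` has compact support. -/
theorem conjTmul_op_smul_mem_H1 {b : ℝ → A} {k : ℝ → H} (hb : Continuous b) (hk : Continuous k)
    (h : HasCompactSupport b ∨ HasCompactSupport k) (e : L) :
    (fun x => conjTmul π (op (b x) • e) (k x)) ∈ H1 D π := by
  refine ⟨fun j x => π (star (D.coord j e (b x))) (k x),
    fun j => ⟨continuous_rep_apply π (by fun_prop) hk, ?_⟩,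
    fun x => D.conjTmul_eq_sum π (op (b x) • e) (k x)⟩
  rcases h with h | h
  · exact h.mono fun x hx hb => hx (by simp [hb])
  · exact h.mono fun x hx hk => hx (by simp [hk])

theorem exists_isAction {f : D.BL} (hf : f ∈ D.circleFunctions) (v : D.PreH π) :
    ∃ w : D.PreH π, D.IsAction π f v w := by
  have hf0 := D.continuous_f0_of_mem_circleFunctions hf
  obtain ⟨⟨c, hc, hf1⟩, F, hF⟩ := hf
  obtain ⟨k, hk, hv⟩ := v.2.2
  have hv0 : Continuous v.v0 := v.1.continuous.comp OnePoint.continuous_coe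
  have hp : ∀ x, pairAct π (v.v1 x) (f.f1 x) = ∑ j, ∑ i,
      π (c i x * pair A (D.basis.vec i) (D.basis.vec j)) (k j x) := by
    intro x
    rw [PreH.v1, hv, hf1, map_sum, Finset.sum_apply]
    refine Finset.sum_congr rfl fun j _ => ?_
    rw [pairAct_tmul, pair_sum_left, map_sum, sum_apply]
    simp only [pair_smul_left]
  have hpc : Continuous fun x : ℝ => (x : ℂ) ^ 2 • pairAct π (v.v1 x) (f.f1 x) := by
    simp only [hp]
    refine (by fun_prop : Continuous fun x : ℝ => (x : ℂ) ^ 2).smul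
      (continuous_finsetSum _ fun j _ => continuous_finsetSum _ fun i _ =>
        continuous_rep_apply π ((hc i).1.mul continuous_const) (hk j).1)
  have hps : HasCompactSupport fun x : ℝ => (x : ℂ) ^ 2 • pairAct π (v.v1 x) (f.f1 x) := by
    refine HasCompactSupport.intro (isCompact_iUnion fun i => (hk i).2.isCompact) fun x hx => ?_
    simp only [Set.mem_iUnion, not_exists] at hx
    simp [hp, fun i => image_eq_zero_of_notMem_tsupport (hx i)]
  obtain ⟨G, hG⟩ := exists_onePoint_extension_of_hasCompactSupport hpc hps
  let w0 : C(OnePoint ℝ, H) :=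
    ⟨fun x => π (F x) (v.1 x), continuous_rep_apply π F.continuous v.1.continuous⟩
  have h1 : (fun x => conjTmul π (D.invol.st (f.f1 x)) (v.v0 x)) ∈ H1 D π := by
    have : (fun x => conjTmul π (D.invol.st (f.f1 x)) (v.v0 x)) = fun x =>
        ∑ i, conjTmul π (op (star (c i x)) • D.invol.st (D.basis.vec i)) (v.v0 x) := by
      funext x
      rw [hf1, D.st_sum, conjTmul_sum_left]
      simp only [D.invol.st_smul]
    rw [this]
    exact D.sum_mem_H1 π fun i => D.conjTmul_op_smul_mem_H1 π (hc i).1.star hv0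
      (Or.inl ((hc i).2.comp_left (star_zero A))) _
  have h2 : (fun x => leftAct π (f.f0 x) (v.v1 x)) ∈ H1 D π := by
    have : (fun x => leftAct π (f.f0 x) (v.v1 x)) = fun x =>
        ∑ i, conjTmul π (op (star (f.f0 x)) • D.basis.vec i) (k i x) := by
      funext x
      rw [PreH.v1, hv, map_sum]
      simp only [leftAct_tmul]
    rw [this]
    exact D.sum_mem_H1 π fun i => D.conjTmul_op_smul_mem_H1 π hf0.star (hk i).1
      (Or.inr (hk i).2) _
  refine ⟨(w0 + G, ⟨_, (H1 D π).add_mem h1 h2⟩), fun x => ?_, fun x => rfl⟩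
  change π (F x) (v.1 x) + G x = _
  rw [hG, hF]
  rfl

variable {D π}

theorem PreH.ext {v w : D.PreH π} (h0 : ∀ x, v.v0 x = w.v0 x) (h1 : ∀ x, v.v1 x = w.v1 x) :
    v = w := by
  refine Prod.ext ?_ (Subtype.ext (funext h1))
  -- `ℝ` is dense in its one-point compactification
  exact DFunLike.coe_injective
    (OnePoint.denseRange_coe.equalizer v.1.continuous w.1.continuous (funext h0))

theorem IsAction.unique {f : D.BL} {v w w' : D.PreH π} (h : D.IsAction π f v w)
    (h' : D.IsAction π f v w') : w = w' :=
  PreH.ext (fun x => (h.1 x).trans (h'.1 x).symm) fun x => (h.2 x).trans (h'.2 x).symm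

theorem IsAction.add_right {f : D.BL} {v w v' w' : D.PreH π} (h : D.IsAction π f v w)
    (h' : D.IsAction π f v' w') : D.IsAction π f (v + v') (w + w') := by
  refine ⟨fun x => ?_, fun x => ?_⟩
  · simp only [PreH.v0_add, PreH.v1_add, h.1 x, h'.1 x, map_add, Pi.add_apply, smul_add]
    abel
  · simp only [PreH.v0_add, PreH.v1_add, h.2 x, h'.2 x, map_add, conjTmul_add_right]
    abel

theorem IsAction.smul_right {f : D.BL} {v w : D.PreH π} (z : ℂ) (h : D.IsAction π f v w) :
    D.IsAction π f (z • v) (z • w) := by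
  refine ⟨fun x => ?_, fun x => ?_⟩
  · simp only [PreH.v0_smul, PreH.v1_smul, h.1 x, map_smul, Pi.smul_apply, smul_add]
    rw [smul_comm z]
  · simp only [PreH.v0_smul, PreH.v1_smul, h.2 x, map_smul, conjTmul_smul_right, smul_add]

theorem IsAction.add_left {f g : D.BL} {v w w' : D.PreH π} (h : D.IsAction π f v w)
    (h' : D.IsAction π g v w') : D.IsAction π (f + g) v (w + w') := by
  refine ⟨fun x => ?_, fun x => ?_⟩
  · simp only [PreH.v0_add, h.1 x, h'.1 x, add_fst, add_snd, pairAct_add, map_add, smul_add,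
      add_apply]
    abel
  · simp only [PreH.v1_add, h.2 x, h'.2 x, add_fst, add_snd, D.invol.st_add,
      conjTmul_add_left, leftAct_add]
    abel

theorem IsAction.smul_left {f : D.BL} {v w : D.PreH π} (z : ℂ) (h : D.IsAction π f v w) :
    D.IsAction π (z • f) v (z • w) := by
  refine ⟨fun x => ?_, fun x => ?_⟩
  · simp only [PreH.v0_smul, h.1 x, smul_fst, smul_snd, pairAct_csmul, map_smul, smul_add,
      smul_apply]
    rw [smul_comm z]
  · simp only [PreH.v1_smul, h.2 x, smul_fst, smul_snd, D.invol.st_csmul,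
      conjTmul_csmul_left, leftAct_csmul, smul_add, Complex.conj_conj]

theorem IsAction.one (v : D.PreH π) : D.IsAction π 1 v v := by
  refine ⟨fun x => ?_, fun x => ?_⟩
  · simp only [one_fst, one_snd, map_one, show pairAct π (v.v1 x) 0 = 0 by
      simpa using pairAct_csmul π (v.v1 x) 0 0, smul_zero, add_zero]
    rfl
  · simp only [one_fst, one_snd, D.st_zero, conjTmul_zero_left, leftAct_one, zero_add]

theorem IsAction.mul {f g : D.BL} {u v w : D.PreH π} (hg : D.IsAction π g u v)
    (hf : D.IsAction π f v w) : D.IsAction π (f * g) u w := by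
  refine ⟨fun x => ?_, fun x => ?_⟩
  · simp only [hf.1 x, hg.1 x, hg.2 x, mul_fst, mul_snd, pairAct_add, map_add, map_mul,
      Pi.add_apply, map_smul, pairAct_smul, D.pairAct_op_smul, pairAct_tmul, smul_add,
      add_apply, smul_apply]
    simp only [mul_apply_eq_comp]
    abel
  · simp only [hf.2 x, hg.1 x, hg.2 x, mul_fst, mul_snd, D.invol.st_add, D.invol.st_smul,
      D.invol.st_op_smul, conjTmul_add_left, conjTmul_add_right, conjTmul_smul_right,
      conjTmul_smul_left, map_add, leftAct_add, leftAct_csmul, leftAct_mul, leftAct_tmul,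
      D.conjTmul_pairAct, star_star]
    abel

/-- `f*` acts as the formal adjoint of `f`, and this holds fibrewise. -/
theorem IsAction.preInnerFun_eq {f : D.BL} {v w v' w' : D.PreH π} (h : D.IsAction π f v w)
    (h' : D.IsAction π (star f) v' w') (x : ℝ) :
    D.preInnerFun π w v' x = D.preInnerFun π v w' x := by
  have hx : conj ((x : ℂ) ^ 2) = (x : ℂ) ^ 2 := by simp
  have hadj : ∀ a : A, ∀ u u' : H, inner ℂ (π a u) u' = inner ℂ u (π (star a) u') := by
    intro a u u'
    rw [map_star, ContinuousLinearMap.star_eq_adjoint, ContinuousLinearMap.adjoint_inner_right]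
  simp only [preInnerFun, h.1 x, h.2 x, h'.1 x, h'.2 x, star_fst, star_snd, inner_add_left,
    inner_add_right, inner_smul_left, inner_smul_right, tensorInner_add_left,
    tensorInner_add_right, inner_pairAct, D.tensorInner_leftAct, tensorInner_tmul_left,
    D.invol.st_st, hx, hadj]
  ring

theorem IsAction.inner_eq {f : D.BL} {v w v' w' : D.PreH π} (h : D.IsAction π f v w)
    (h' : D.IsAction π (star f) v' w') : (inner ℂ w v' : ℂ) = inner ℂ v w' :=
  integral_congr_ae (ae_of_all _ fun x => h.preInnerFun_eq h' x)

theorem preInnerFun_self_re (v : D.PreH π) (x : ℝ) : (D.preInnerFun π v v x).re =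
    (‖v.v0 x‖ ^ 2 + x ^ 2 * (tensorInner π (v.v1 x) (v.v1 x)).re) / (1 + x ^ 2) := by
  have h2 : D.preInnerFun π v v x = (inner ℂ (v.v0 x) (v.v0 x) +
      ((x ^ 2 : ℝ) : ℂ) * tensorInner π (v.v1 x) (v.v1 x)) / ((1 + x ^ 2 : ℝ) : ℂ) := by
    simp [preInnerFun]
  rw [h2, Complex.div_ofReal_re, Complex.add_re, Complex.re_ofReal_mul]
  congr 2
  exact inner_self_eq_norm_sq (𝕜 := ℂ) _

theorem norm_sq_eq_integral (v : D.PreH π) :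
    ‖v‖ ^ 2 = ∫ x, (D.preInnerFun π v v x).re := by
  rw [← inner_self_eq_norm_sq (𝕜 := ℂ) v]
  exact (integral_re (D.integrable_preInnerFun π v v)).symm

/-- The fibrewise estimate for `f ▷ v`, by the parallelogram inequality
`‖a + b‖² ≤ 2 ‖a‖² + 2 ‖b‖²` in both components. -/
theorem IsAction.preInnerFun_le {f : D.BL} {v w : D.PreH π} (h : D.IsAction π f v w) (x : ℝ) :
    (D.preInnerFun π w w x).re ≤ 2 * (‖f.f0 x‖ ^ 2 + x ^ 2 *
      (‖pair A (D.invol.st (f.f1 x)) (D.invol.st (f.f1 x))‖ + ‖pair A (f.f1 x) (f.f1 x)‖)) *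
      (D.preInnerFun π v v x).re := by
  rw [preInnerFun_self_re, preInnerFun_self_re, mul_div_assoc']
  refine div_le_div_of_nonneg_right ?_ (by positivity)
  set p := ‖pair A (D.invol.st (f.f1 x)) (D.invol.st (f.f1 x))‖
  set q := ‖pair A (f.f1 x) (f.f1 x)‖
  set V := (tensorInner π (v.v1 x) (v.v1 x)).re with hV
  have hV0 : 0 ≤ V := D.tensorInner_self_nonneg π _
  have hp : 0 ≤ p := norm_nonneg _
  have hq : 0 ≤ q := norm_nonneg _
  have h0 : ‖w.v0 x‖ ^ 2 ≤ 2 * (‖f.f0 x‖ ^ 2 * ‖v.v0 x‖ ^ 2) + 2 * ((x ^ 2) ^ 2 * (q * V)) := by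
    have h1 := norm_apply_le π (f.f0 x) (v.v0 x)
    have h2 := D.norm_pairAct_sq_le π (v.v1 x) (f.f1 x)
    have h3 : ‖w.v0 x‖ ≤ ‖f.f0 x‖ * ‖v.v0 x‖ + x ^ 2 * ‖pairAct π (v.v1 x) (f.f1 x)‖ := by
      rw [h.1 x]
      refine (norm_add_le _ _).trans (add_le_add h1 (le_of_eq ?_))
      rw [norm_smul, norm_pow, Complex.norm_real, Real.norm_eq_abs, sq_abs]
    calc ‖w.v0 x‖ ^ 2 ≤ (‖f.f0 x‖ * ‖v.v0 x‖ + x ^ 2 * ‖pairAct π (v.v1 x) (f.f1 x)‖) ^ 2 := by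
          gcongr
      _ ≤ 2 * (‖f.f0 x‖ * ‖v.v0 x‖) ^ 2 + 2 * (x ^ 2 * ‖pairAct π (v.v1 x) (f.f1 x)‖) ^ 2 := by
          nlinarith [sq_nonneg (‖f.f0 x‖ * ‖v.v0 x‖ - x ^ 2 * ‖pairAct π (v.v1 x) (f.f1 x)‖)]
      _ ≤ _ := by
          rw [mul_pow, mul_pow]
          gcongr
  have h1 : (tensorInner π (w.v1 x) (w.v1 x)).re ≤ 2 * (p * ‖v.v0 x‖ ^ 2) +
      2 * (‖f.f0 x‖ ^ 2 * V) := by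
    set s := conjTmul π (D.invol.st (f.f1 x)) (v.v0 x) with hs
    set t := leftAct π (f.f0 x) (v.v1 x) with ht
    have h2 : (tensorInner π s s).re ≤ p * ‖v.v0 x‖ ^ 2 := tensorInner_tmul_self_le π _ _
    have h3 : (tensorInner π t t).re ≤ ‖f.f0 x‖ ^ 2 * V := D.tensorInner_leftAct_self_le π _ _
    have h4 := D.tensorInner_self_nonneg π (s - t)
    have h5 : tensorInner π (s + t) (s + t) + tensorInner π (s - t) (s - t) =
        2 * tensorInner π s s + 2 * tensorInner π t t := by
      have h6 : ∀ y, tensorInner π (s - t) y = tensorInner π s y - tensorInner π t y := by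
        intro y
        rw [eq_sub_iff_add_eq, ← tensorInner_add_left, sub_add_cancel]
      simp only [tensorInner_add_left, tensorInner_add_right, h6, tensorInner_sub_right]
      ring
    have h7 := congrArg Complex.re h5
    simp only [two_mul, Complex.add_re] at h7
    rw [h.2 x, ← hs, ← ht]
    linarith
  have hx : 0 ≤ x ^ 2 := sq_nonneg x
  have h2 : x ^ 2 * (tensorInner π (w.v1 x) (w.v1 x)).re ≤ x ^ 2 * (2 * (p * ‖v.v0 x‖ ^ 2) +
      2 * (‖f.f0 x‖ ^ 2 * V)) := mul_le_mul_of_nonneg_left h1 hx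
  have h3 : 0 ≤ x ^ 2 * q * ‖v.v0 x‖ ^ 2 := by positivity
  have h4 : 0 ≤ x ^ 2 * p * (x ^ 2 * V) := by positivity
  nlinarith

/-- The bound `S` is needed only on the support of `v`: for vectors supported far out it can be much
smaller than the supremum over `ℝ`. -/
theorem IsAction.norm_le {f : D.BL} {v w : D.PreH π} (h : D.IsAction π f v w) {S : ℝ}
    (hS : ∀ x, D.preInnerFun π v v x ≠ 0 → ‖f.f0 x‖ ^ 2 + x ^ 2 *
      (‖pair A (D.invol.st (f.f1 x)) (D.invol.st (f.f1 x))‖ + ‖pair A (f.f1 x) (f.f1 x)‖) ≤ S) :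
    ‖w‖ ≤ √2 * √S * ‖v‖ := by
  have h1 : ‖w‖ ^ 2 ≤ 2 * S * ‖v‖ ^ 2 := by
    rw [norm_sq_eq_integral, norm_sq_eq_integral, ← integral_const_mul]
    refine integral_mono (D.integrable_preInnerFun π w w).re
      ((D.integrable_preInnerFun π v v).re.const_mul _) fun x => ?_
    refine (h.preInnerFun_le x).trans ?_
    by_cases hx : D.preInnerFun π v v x = 0
    · simp [hx]
    · refine mul_le_mul_of_nonneg_right (by linarith [hS x hx]) ?_
      rw [preInnerFun_self_re]
      have := D.tensorInner_self_nonneg π (v.v1 x)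
      positivity
  rw [← Real.sqrt_mul zero_le_two, ← Real.sqrt_sq (norm_nonneg w)]
  refine Real.sqrt_le_iff.2 ⟨by positivity, ?_⟩
  rcases (norm_nonneg v).eq_or_lt with hv | hv
  · rw [← hv] at h1 ⊢
    linarith
  have hS0 : 0 ≤ 2 * S := by
    by_contra! hneg
    have h2 : 2 * S * ‖v‖ ^ 2 < 0 := mul_neg_of_neg_of_pos hneg (by positivity)
    linarith [sq_nonneg ‖w‖]
  rw [mul_pow, Real.sq_sqrt hS0]
  exact h1

end Action

/-! ### The representation on `H_{0,1}` -/

section Representation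

variable {A : Type*} [CStarAlgebra A] [PartialOrder A] [StarOrderedRing A]
  {L : Type*} [NormedAddCommGroup L] [Module ℂ L] [Module A L] [Module Aᵐᵒᵖ L]
  [SMulCommClass A Aᵐᵒᵖ L] [IsScalarTower ℂ A L] [IsScalarTower ℂ Aᵐᵒᵖ L]
  [CStarModule A L] {n : ℕ} (D : HermitianLine A L n)
  {H : Type*} [NormedAddCommGroup H] [InnerProductSpace ℂ H] [CompleteSpace H]
  (π : A →⋆ₐ[ℂ] (H →L[ℂ] H))

/-- The quantity `sup |f₀|² + sup x² (|⟨f₁*, \overline{f₁*}⟩| + |⟨f₁, \overline{f₁}⟩|)`. -/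
def supBound (f : D.BL) : ℝ :=
  (⨆ x : ℝ, ‖f.f0 x‖ ^ 2) + ⨆ x : ℝ, x ^ 2 *
    (‖pair A (D.invol.st (f.f1 x)) (D.invol.st (f.f1 x))‖ + ‖pair A (f.f1 x) (f.f1 x)‖)

/-- Both suprema in `supBound` are taken over bounded families, so they are not junk values. -/
theorem le_supBound {f : D.BL} (hf : f ∈ D.circleFunctions) (x : ℝ) :
    ‖f.f0 x‖ ^ 2 + x ^ 2 * (‖pair A (D.invol.st (f.f1 x)) (D.invol.st (f.f1 x))‖ +
      ‖pair A (f.f1 x) (f.f1 x)‖) ≤ D.supBound f := by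
  obtain ⟨h1, F, hF⟩ := hf
  have hb0 : BddAbove (Set.range fun x : ℝ => ‖f.f0 x‖ ^ 2) := by
    refine ⟨‖F‖ ^ 2, ?_⟩
    rintro _ ⟨x, rfl⟩
    simp only [hF]
    gcongr
    exact F.norm_coe_le_norm _
  have hb1 : BddAbove (Set.range fun x : ℝ => x ^ 2 *
      (‖pair A (D.invol.st (f.f1 x)) (D.invol.st (f.f1 x))‖ +
        ‖pair A (f.f1 x) (f.f1 x)‖)) := by
    obtain ⟨hc, hs⟩ := D.continuous_pair h1 h1
    have h2 := D.st_mem_compactSections h1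
    obtain ⟨hc', hs'⟩ := D.continuous_pair h2 h2
    refine Continuous.bddAbove_range_of_hasCompactSupport
      ((continuous_pow 2).mul (hc'.norm.add hc.norm)) ?_
    exact (hs'.norm.add hs.norm).mul_left
  exact add_le_add (le_ciSup hb0 x) (le_ciSup hb1 x)

/-- The operator `v ↦ f ▷ v` on `H₀ ⊕ H₁`. -/
def actionMap (f : D.circleSubalgebra) : D.PreH π →L[ℂ] D.PreH π :=
  LinearMap.mkContinuous
    { toFun := fun v => (D.exists_isAction π f.2 v).choose
      map_add' := fun v w => (D.exists_isAction π f.2 (v + w)).choose_spec.unique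
        ((D.exists_isAction π f.2 v).choose_spec.add_right
          (D.exists_isAction π f.2 w).choose_spec)
      map_smul' := fun z v => (D.exists_isAction π f.2 (z • v)).choose_spec.unique
        ((D.exists_isAction π f.2 v).choose_spec.smul_right z) }
    (√2 * √(D.supBound f))
    fun v => (D.exists_isAction π f.2 v).choose_spec.norm_le fun x _ => D.le_supBound f.2 x

theorem isAction_actionMap (f : D.circleSubalgebra) (v : D.PreH π) :
    D.IsAction π f v (D.actionMap π f v) :=
  (D.exists_isAction π f.2 v).choose_spec

variable {D π} in
theorem H01_hom_ext {S T : D.H01 π →L[ℂ] D.H01 π}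
    (h : ∀ v : D.PreH π, S (v : D.H01 π) = T (v : D.H01 π)) : S = T :=
  DFunLike.coe_injective (UniformSpace.Completion.ext S.continuous T.continuous h)

/-- The representation `ρ` of the algebra of class (c) on `H_{0,1}`. -/
def rho : D.circleSubalgebra →⋆ₐ[ℂ] (D.H01 π →L[ℂ] D.H01 π) where
  toFun f := (D.actionMap π f).completion
  map_one' := H01_hom_ext fun v => by
    rw [ContinuousLinearMap.completion_apply_coe]
    exact congrArg _ ((D.isAction_actionMap π 1 v).unique (IsAction.one v))
  map_zero' := H01_hom_ext fun v => by
    rw [ContinuousLinearMap.completion_apply_coe]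
    have h := (IsAction.one v).smul_left 0
    rw [zero_smul, zero_smul] at h
    exact congrArg _ ((D.isAction_actionMap π 0 v).unique h)
  map_mul' f g := H01_hom_ext fun v => by
    rw [ContinuousLinearMap.completion_apply_coe, mul_apply_eq_comp,
      ContinuousLinearMap.completion_apply_coe, ContinuousLinearMap.completion_apply_coe]
    exact congrArg _ ((D.isAction_actionMap π (f * g) v).unique
      ((D.isAction_actionMap π g v).mul (D.isAction_actionMap π f _)))
  map_add' f g := H01_hom_ext fun v => by
    rw [ContinuousLinearMap.completion_apply_coe, add_apply,
      ContinuousLinearMap.completion_apply_coe, ContinuousLinearMap.completion_apply_coe,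
      ← UniformSpace.Completion.coe_add]
    exact congrArg _ ((D.isAction_actionMap π (f + g) v).unique
      ((D.isAction_actionMap π f v).add_left (D.isAction_actionMap π g v)))
  commutes' z := H01_hom_ext fun v => by
    rw [ContinuousLinearMap.completion_apply_coe, Algebra.algebraMap_eq_smul_one,
      Algebra.algebraMap_eq_smul_one, smul_apply, one_apply_eq_self,
      ← UniformSpace.Completion.coe_smul]
    exact congrArg _ ((D.isAction_actionMap π (z • 1) v).unique ((IsAction.one v).smul_left z))
  map_star' f := by
    rw [ContinuousLinearMap.star_eq_adjoint, ContinuousLinearMap.eq_adjoint_iff]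
    intro v w
    induction v, w using UniformSpace.Completion.induction_on₂ with
    | hp => exact isClosed_eq (by fun_prop) (by fun_prop)
    | ih v w =>
      rw [ContinuousLinearMap.completion_apply_coe, ContinuousLinearMap.completion_apply_coe,
        UniformSpace.Completion.inner_coe, UniformSpace.Completion.inner_coe]
      refine (D.isAction_actionMap π (star f) v).inner_eq ?_
      rw [StarMemClass.coe_star, star_star]
      exact D.isAction_actionMap π f w

theorem rho_coe (f : D.circleSubalgebra) (v : D.PreH π) :
    D.rho π f (v : D.H01 π) = (D.actionMap π f v : D.H01 π) :=
  ContinuousLinearMap.completion_apply_coe _ _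

theorem norm_rho_le (f : D.circleSubalgebra) : ‖D.rho π f‖ ≤ √2 * √(D.supBound f) := by
  refine ContinuousLinearMap.opNorm_le_bound _ (by positivity) fun v => ?_
  induction v using UniformSpace.Completion.induction_on with
  | hp => exact isClosed_le (by fun_prop) (by fun_prop)
  | ih v =>
    rw [rho_coe, UniformSpace.Completion.norm_coe, UniformSpace.Completion.norm_coe]
    exact (D.isAction_actionMap π f v).norm_le fun x _ => D.le_supBound f.2 x

/-! ### The operator algebras -/

/-- The norm closure of the image of the algebra of class (a). -/
def vanishingClosure : NonUnitalStarSubalgebra ℂ (D.H01 π →L[ℂ] D.H01 π) :=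
  ((D.vanishingSubalgebra.comap D.circleSubalgebra.subtype.toNonUnitalStarAlgHom).map
    (D.rho π).toNonUnitalStarAlgHom).topologicalClosure

theorem coe_vanishingClosure : (D.vanishingClosure π : Set (D.H01 π →L[ℂ] D.H01 π)) =
    closure (D.rho π '' {f | (f : D.BL) ∈ D.vanishingSubalgebra}) := rfl

/-- The norm closure of the image of the algebra of class (b). -/
def thomClosure : StarSubalgebra ℂ (D.H01 π →L[ℂ] D.H01 π) :=
  ((D.thomSubalgebra.comap D.circleSubalgebra.subtype).map (D.rho π)).topologicalClosure

theorem coe_thomClosure : (D.thomClosure π : Set (D.H01 π →L[ℂ] D.H01 π)) =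
    closure (D.rho π '' {f | (f : D.BL) ∈ D.thomSubalgebra}) := rfl

/-- Adjoining `ℂ 1` to the closed algebra of class (a) yields a closed algebra, which is therefore
the closure of the algebra of class (b). -/
theorem adjoin_vanishingClosure :
    StarAlgebra.adjoin ℂ (D.vanishingClosure π : Set (D.H01 π →L[ℂ] D.H01 π)) =
      D.thomClosure π := by
  apply le_antisymm
  · refine StarAlgebra.adjoin_le ?_
    rw [coe_vanishingClosure, coe_thomClosure]
    refine closure_mono (Set.image_mono fun f hf => ?_)
    exact ⟨f, hf, 0, by rw [zero_smul, zero_add]⟩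
  · let V : Submodule ℂ (D.H01 π →L[ℂ] D.H01 π) :=
      (D.vanishingClosure π).toNonUnitalSubalgebra.toSubmodule
    have hV : IsClosed (V : Set (D.H01 π →L[ℂ] D.H01 π)) :=
      NonUnitalStarSubalgebra.isClosed_topologicalClosure _
    have hW := Submodule.isClosed_sup_finiteDimensional V (ℂ ∙ (1 : D.H01 π →L[ℂ] D.H01 π)) hV
    have h1 : (D.thomClosure π : Set (D.H01 π →L[ℂ] D.H01 π)) ⊆
        (V ⊔ ℂ ∙ (1 : D.H01 π →L[ℂ] D.H01 π) : Submodule ℂ _) := by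
      rw [coe_thomClosure]
      refine closure_minimal ?_ hW
      rintro _ ⟨f, ⟨g, hg, z, hz⟩, rfl⟩
      have hf : f = z • 1 + ⟨g, D.vanishingFunctions_subset_circleFunctions hg⟩ :=
        Subtype.ext hz
      rw [hf, map_add, map_smul, map_one, add_comm]
      exact Submodule.add_mem_sup (subset_closure ⟨_, hg, rfl⟩)
        (Submodule.smul_mem _ _ (Submodule.mem_span_singleton_self _))
    intro T hT
    obtain ⟨S, hS, y, hy, rfl⟩ := Submodule.mem_sup.1 (h1 hT)
    obtain ⟨z, rfl⟩ := Submodule.mem_span_singleton.1 hy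
    exact add_mem (StarAlgebra.subset_adjoin ℂ _ hS) (SMulMemClass.smul_mem z (one_mem _))

/-- The bump functions `ψ` far out on `ℝ` give vectors `v = (ψ u, 0)` on which some `ρ(f)` with `f`
in class (a) acts as the identity, whereas `ρ(g) v` is small compared with `v` for a given `g` in
class (a).  A unit would be the identity on all such `v` and a limit of such `ρ(g)`. -/
theorem not_exists_unit_vanishingClosure [Nontrivial A] (hπ : Function.Injective π) :
    ¬ ∃ e ∈ D.vanishingClosure π, ∀ T ∈ D.vanishingClosure π, e * T = T ∧ T * e = T := by
  obtain ⟨u, hu⟩ : ∃ u : H, u ≠ 0 := by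
    by_contra! h
    refine one_ne_zero (hπ (?_ : π (1 : A) = π 0))
    ext u
    rw [h (π 1 u), h (π 0 u)]
  rintro ⟨e, he, hunit⟩
  rw [← SetLike.mem_coe, coe_vanishingClosure, Metric.mem_closure_iff] at he
  obtain ⟨_, ⟨g, hg, rfl⟩, hge⟩ := he (1 / 2) (by norm_num)
  rw [dist_eq_norm] at hge
  obtain ⟨⟨c, hc, hg1⟩, G, hG⟩ := id hg
  -- outside `[-R, R]` the function `g₀` is small and `g₁` vanishes
  obtain ⟨R, hR⟩ : ∃ R : ℝ, ∀ x, R < x → ‖(g : D.BL).f0 x‖ ≤ 1 / 4 ∧ (g : D.BL).f1 x = 0 := by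
    have h1 : ∀ᶠ x in Filter.cocompact ℝ, ‖G x‖ < 1 / 4 := by
      have := G.zero_at_infty'.norm
      rw [norm_zero] at this
      exact this.eventually (gt_mem_nhds (by norm_num))
    have h2 : ∀ i, ∀ᶠ x in Filter.cocompact ℝ, c i x = 0 := fun i => by
      filter_upwards [(hc i).2.isCompact.compl_mem_cocompact] with x hx
      exact image_eq_zero_of_notMem_tsupport hx
    obtain ⟨R, hR⟩ := Filter.eventually_atTop.1
      (atTop_le_cocompact (h1.and (Filter.eventually_all.2 h2)))
    refine ⟨R, fun x hx => ?_⟩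
    obtain ⟨h3, h4⟩ := hR x hx.le
    rw [hG, hg1]
    exact ⟨h3.le, by simp [h4]⟩
  let ψ : ContDiffBump (R + 1) := ⟨1 / 2, 1, by norm_num, by norm_num⟩
  let φ : ContDiffBump (R + 1) := ⟨1, 2, by norm_num, by norm_num⟩
  have hφψ : ∀ x, ψ x ≠ 0 → φ x = 1 ∧ R < x := by
    intro x hx
    have h1 : x ∈ Metric.ball (R + 1) 1 := by
      rw [← show Function.support ψ = Metric.ball (R + 1) 1 from ψ.support_eq]
      exact hx
    refine ⟨φ.one_of_mem_closedBall (Metric.ball_subset_closedBall h1), ?_⟩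
    rw [Metric.mem_ball, Real.dist_eq, abs_lt] at h1
    linarith [h1.1]
  obtain ⟨V, hV⟩ := exists_onePoint_extension_of_hasCompactSupport
    (g := fun x : ℝ => (ψ x : ℂ) • u)
    ((Complex.continuous_ofReal.comp ψ.continuous).smul continuous_const)
    (ψ.hasCompactSupport.mono fun x hx h => hx (by simp [h]))
  let v : D.PreH π := (V, 0)
  have hv0 : ∀ x, v.v0 x = (ψ x : ℂ) • u := hV
  have hv1 : ∀ x, v.v1 x = 0 := fun x => rfl
  have hre : ∀ x, (D.preInnerFun π v v x).re = ‖(ψ x : ℂ) • u‖ ^ 2 / (1 + x ^ 2) := by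
    intro x
    rw [preInnerFun_self_re, hv0, hv1, tensorInner_zero_left, Complex.zero_re, mul_zero, add_zero]
  have hnorm : 0 < ‖v‖ := by
    have h1 : 0 < ‖v‖ ^ 2 := by
      rw [norm_sq_eq_integral]
      simp only [hre]
      refine Continuous.integral_pos_of_hasCompactSupport_nonneg_nonzero (x := R + 1)
        ?_ ?_ (fun x => by positivity) ?_
      · refine Continuous.div (((Complex.continuous_ofReal.comp ψ.continuous).smul
          continuous_const).norm.pow 2) (by fun_prop) fun x => by positivity
      · exact ψ.hasCompactSupport.mono fun x hx h => hx (by simp [h])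
      · have h2 : ψ (R + 1) = 1 := ψ.one_of_mem_closedBall (by simp [ψ])
        rw [h2, Complex.ofReal_one, one_smul]
        have := norm_pos_iff.2 hu
        positivity
    exact (norm_nonneg v).lt_of_ne fun h => by simp [← h] at h1
  -- the scalar function `φ` as an element of class (a)
  let f : D.BL := ⟨fun x => (φ x : ℂ) • 1, 0⟩
  have hf : f ∈ D.vanishingFunctions := by
    refine ⟨D.compactSections.zero_mem, ⟨⟨fun x => (φ x : ℂ) • 1,
      (Complex.continuous_ofReal.comp φ.continuous).smul continuous_const⟩,
      HasCompactSupport.is_zero_at_infty ?_⟩, fun x => rfl⟩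
    exact φ.hasCompactSupport.mono fun x hx h => hx (by simp [h])
  let f' : D.circleSubalgebra := ⟨f, D.vanishingFunctions_subset_circleFunctions hf⟩
  have hfv : D.IsAction π f v v := by
    refine ⟨fun x => ?_, fun x => ?_⟩
    · change v.v0 x = π ((φ x : ℂ) • 1) (v.v0 x) + (x : ℂ) ^ 2 • pairAct π (v.v1 x) 0
      rw [hv0, hv1, map_zero, Pi.zero_apply, smul_zero, add_zero, map_smul π, map_one]
      by_cases hx : ψ x = 0
      · simp [hx]
      · simp [(hφψ x hx).1]
    · change v.v1 x = conjTmul π (D.invol.st 0) (v.v0 x) + leftAct π ((φ x : ℂ) • 1) (v.v1 x)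
      rw [hv1, map_zero, D.st_zero, conjTmul_zero_left, add_zero]
  have hfix : D.rho π f' (v : D.H01 π) = v := by
    rw [rho_coe]
    exact congrArg _ ((D.isAction_actionMap π f' v).unique hfv)
  have hev : e (v : D.H01 π) = v := by
    have h1 := (hunit (D.rho π f') (subset_closure ⟨f', hf, rfl⟩)).1
    have h2 := DFunLike.congr_fun h1 (v : D.H01 π)
    rw [mul_apply_eq_comp, hfix] at h2
    exact h2
  have hgv : ‖D.rho π g (v : D.H01 π)‖ ≤ √2 * √((1 / 4) ^ 2) * ‖(v : D.H01 π)‖ := by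
    rw [rho_coe, UniformSpace.Completion.norm_coe, UniformSpace.Completion.norm_coe]
    refine (D.isAction_actionMap π g v).norm_le fun x hx => ?_
    have hψ : ψ x ≠ 0 := by
      intro h0
      refine hx ?_
      simp [preInnerFun, hv0, hv1, h0, tensorInner_zero_left]
    obtain ⟨h1, h2⟩ := hR x (hφψ x hψ).2
    rw [h2, D.st_zero, pair_zero_left, norm_zero, add_zero, mul_zero, add_zero]
    gcongr
  have h1 : ‖(v : D.H01 π)‖ ≤ 1 / 2 * ‖(v : D.H01 π)‖ + √2 * √((1 / 4) ^ 2) * ‖(v : D.H01 π)‖ :=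
    calc ‖(v : D.H01 π)‖ = ‖(e - D.rho π g) v + D.rho π g v‖ := by
          rw [sub_apply, sub_add_cancel, hev]
      _ ≤ _ := (norm_add_le _ _).trans (add_le_add
          (((e - D.rho π g).le_opNorm _).trans (by gcongr)) hgv)
  rw [Real.sqrt_sq (by norm_num)] at h1
  rw [UniformSpace.Completion.norm_coe] at h1
  have h2 : √2 < 2 := (Real.sqrt_lt' two_pos).2 (by norm_num)
  nlinarith

theorem one_notMem_vanishingClosure [Nontrivial A] (hπ : Function.Injective π) :
    (1 : D.H01 π →L[ℂ] D.H01 π) ∉ D.vanishingClosure π := fun h =>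
  D.not_exists_unit_vanishingClosure π hπ ⟨1, h, fun T _ => ⟨one_mul T, mul_one T⟩⟩

end Representation

end HermitianLine

end

theorem mainTheorem5
    {A : Type*} [CStarAlgebra A] [PartialOrder A] [StarOrderedRing A] [Nontrivial A]
    {L : Type*} [NormedAddCommGroup L] [Module ℂ L] [Module A L] [Module Aᵐᵒᵖ L]
    [SMulCommClass A Aᵐᵒᵖ L] [IsScalarTower ℂ A L] [IsScalarTower ℂ Aᵐᵒᵖ L]
    [CStarModule A L] [CompleteSpace L]
    {n : ℕ} (D : HermitianLine A L n) :
    -- the three classes of functions are star subalgebras of `B_L`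
    ∃ (Ba : NonUnitalStarSubalgebra ℂ D.BL) (Bb Bc : StarSubalgebra ℂ D.BL),
      (Ba : Set D.BL) = D.vanishingFunctions ∧ (Bb : Set D.BL) = D.thomFunctions ∧
      (Bc : Set D.BL) = D.circleFunctions ∧
    ∃ C : ℝ, 0 ≤ C ∧
    ∀ {H : Type*} [NormedAddCommGroup H] [InnerProductSpace ℂ H] [CompleteSpace H]
      (π : A →⋆ₐ[ℂ] (H →L[ℂ] H)), Function.Injective π →
    -- the action on `H₀ ⊕ H₁` extends to a star representation by bounded operators on `H_{0,1}`
    ∃ ρ : Bc →⋆ₐ[ℂ] (D.H01 π →L[ℂ] D.H01 π),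
      (∀ (f : Bc) (v : D.PreH π), ∃ w : D.PreH π,
        D.IsAction π f v w ∧ ρ f (v : D.H01 π) = (w : D.H01 π)) ∧
      (∀ f : Bc, ‖ρ f‖ ≤ C * √((⨆ x : ℝ, ‖(f : D.BL).f0 x‖ ^ 2) +
        ⨆ x : ℝ, x ^ 2 *
          (‖pair A (D.invol.st ((f : D.BL).f1 x)) (D.invol.st ((f : D.BL).f1 x))‖ +
            ‖pair A ((f : D.BL).f1 x) ((f : D.BL).f1 x)‖))) ∧
    -- the completions (norm closures of the images) are C⋆-algebras
    ∃ (Ca : NonUnitalStarSubalgebra ℂ (D.H01 π →L[ℂ] D.H01 π))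
      (Cb Cc : StarSubalgebra ℂ (D.H01 π →L[ℂ] D.H01 π)),
      (Ca : Set (D.H01 π →L[ℂ] D.H01 π)) = closure (ρ '' {f | (f : D.BL) ∈ Ba}) ∧
      (Cb : Set (D.H01 π →L[ℂ] D.H01 π)) = closure (ρ '' {f | (f : D.BL) ∈ Bb}) ∧
      (Cc : Set (D.H01 π →L[ℂ] D.H01 π)) = closure (Set.range ρ) ∧
    -- the first has no unit, and the second is its unitization
      (¬ ∃ e ∈ Ca, ∀ T ∈ Ca, e * T = T ∧ T * e = T) ∧
      ∃ Φ : Unitization ℂ Ca ≃⋆ₐ[ℂ] Cb, ∀ (z : ℂ) (T : Ca),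
        (Φ (Unitization.inl z + (T : Unitization ℂ Ca)) : D.H01 π →L[ℂ] D.H01 π) =
          z • 1 + (T : D.H01 π →L[ℂ] D.H01 π) := by
  refine ⟨D.vanishingSubalgebra, D.thomSubalgebra, D.circleSubalgebra, rfl, rfl, rfl, √2,
    Real.sqrt_nonneg 2, ?_⟩
  intro H _ _ _ π hπ
  refine ⟨D.rho π, ?_, D.norm_rho_le π, ?_⟩
  · intro f v
    exact ⟨D.actionMap π f v, D.isAction_actionMap π f v, D.rho_coe π f v⟩
  refine ⟨D.vanishingClosure π,
    StarAlgebra.adjoin ℂ (D.vanishingClosure π : Set (D.H01 π →L[ℂ] D.H01 π)),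
    (D.rho π).range.topologicalClosure, D.coe_vanishingClosure π, ?_, ?_,
    D.not_exists_unit_vanishingClosure π hπ,
    NonUnitalStarSubalgebra.unitizationStarAlgEquiv (D.vanishingClosure π)
      (D.one_notMem_vanishingClosure π hπ), ?_⟩
  · rw [D.adjoin_vanishingClosure π, D.coe_thomClosure]
  · rw [StarSubalgebra.topologicalClosure_coe]
    rfl
  · intro z T
    rw [NonUnitalStarSubalgebra.unitizationStarAlgEquiv_apply_coe]
    simp [Algebra.algebraMap_eq_smul_one]
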